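/- The Hadwiger Number problem can be solved in $O(n^3)$ time on cographs. In detail: the \emph{Hadwiger number} $h(G)$ of a finite simple graph $G$ is the largest integer $p$ such that the complete graph $K_p$ is a minor of $G$, and a \emph{cograph} is a graph with no induced path on four vertices. There are a single program for a random access machine and constants $C,k$ such that, for every cograph $G$ on $n$ vertices (given by $n$ and its adjacency matrix) and every non-negative integer $h$, the program on input $(G,h)$ halts after at most $C(n^3+1)$ steps, and outputs the correct answer to the question whether $h(G)\ge h$, together with the value $h(G)$. Here every instruction (assignment, addition, subtraction, multiplication, indirect load or store, conditional jump) takes one step, and throughout the computation all stored numbers are at most $\max\{h,\,C(n+1)^k\}$, that is, words of $O(\log n)$ bits suffice apart from those needed to write down $h$. -/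

import Mathlib

/-! ### Minors, Hadwiger number, cographs -/

/-- `H` is a minor of `G`: there is a family of pairwise disjoint, nonempty, connected vertex sets
("bags") of `G`, one for every vertex of `H`, such that the bags of adjacent vertices of `H` are
joined by an edge of `G`. (`SimpleGraph.Connected` includes nonemptiness.) -/
def IsGraphMinor {W V : Type*} (H : SimpleGraph W) (G : SimpleGraph V) : Prop :=
  ∃ bag : W → Set V,
    (∀ x, (G.induce (bag x)).Connected) ∧
    (∀ x y, x ≠ y → Disjoint (bag x) (bag y)) ∧
    (∀ x y, H.Adj x y → ∃ u ∈ bag x, ∃ v ∈ bag y, G.Adj u v)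

/-- The largest `p` such that the complete graph on `p` vertices is a minor of `G`. For finite `V`
the set is nonempty (`p = 0`) and bounded by the number of vertices, so the maximum exists. -/
noncomputable def hadwigerNumber {V : Type*} [Finite V] (G : SimpleGraph V) : ℕ :=
  sSup {p : ℕ | IsGraphMinor (⊤ : SimpleGraph (Fin p)) G}

/-- A cograph is a graph without an induced path on four vertices. -/
def IsCograph {V : Type*} (G : SimpleGraph V) : Prop :=
  ¬ (SimpleGraph.pathGraph 4).IsIndContained G

/-! ### Random access machine

A program is a finite list of instructions. A machine has registers, which instructions name
directly, and a memory, which is accessed indirectly, through an address held in a register.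
Every instruction costs one time unit. The size of the words is controlled by `WordsLE`. -/

namespace WordRAM

inductive Instr : Type
  /-- `R d := c` -/
  | const (d c : ℕ)
  /-- `R d := R a` -/
  | move (d a : ℕ)
  /-- `R d := R a + R b` -/
  | add (d a b : ℕ)
  /-- `R d := R a - R b` (truncated at zero) -/
  | sub (d a b : ℕ)
  /-- `R d := R a * R b` -/
  | mul (d a b : ℕ)
  /-- `R d := M (R a)` -/
  | load (d a : ℕ)
  /-- `M (R a) := R b` -/
  | store (a b : ℕ)
  /-- continue at instruction number `l` -/
  | jump (l : ℕ)
  /-- continue at instruction number `l` if `R a < R b`, and with the next instruction otherwise -/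
  | jumpLt (a b l : ℕ)

abbrev Program : Type := List Instr

/-- Program counter, registers, memory. -/
structure Config : Type where
  pc : ℕ
  reg : ℕ → ℕ
  mem : ℕ → ℕ

/-- The effect of one instruction. -/
def Instr.exec : Instr → Config → Config
  | .const d c, s => ⟨s.pc + 1, Function.update s.reg d c, s.mem⟩
  | .move d a, s => ⟨s.pc + 1, Function.update s.reg d (s.reg a), s.mem⟩
  | .add d a b, s => ⟨s.pc + 1, Function.update s.reg d (s.reg a + s.reg b), s.mem⟩
  | .sub d a b, s => ⟨s.pc + 1, Function.update s.reg d (s.reg a - s.reg b), s.mem⟩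
  | .mul d a b, s => ⟨s.pc + 1, Function.update s.reg d (s.reg a * s.reg b), s.mem⟩
  | .load d a, s => ⟨s.pc + 1, Function.update s.reg d (s.mem (s.reg a)), s.mem⟩
  | .store a b, s => ⟨s.pc + 1, s.reg, Function.update s.mem (s.reg a) (s.reg b)⟩
  | .jump l, s => ⟨l, s.reg, s.mem⟩
  | .jumpLt a b l, s => ⟨if s.reg a < s.reg b then l else s.pc + 1, s.reg, s.mem⟩

/-- One step of the machine: execute the instruction at the program counter. A machine whose program
counter is outside the program has halted and does not change any more. -/
def step (P : Program) (s : Config) : Config :=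
  match P[s.pc]? with
  | some i => i.exec s
  | none => s

/-- The configuration after `t` steps. -/
def run (P : Program) (t : ℕ) (s : Config) : Config :=
  (step P)^[t] s

def Halted (P : Program) (s : Config) : Prop :=
  P.length ≤ s.pc

/-- All registers and all memory cells hold numbers that are at most `B`. -/
def WordsLE (B : ℕ) (s : Config) : Prop :=
  (∀ a, s.reg a ≤ B) ∧ ∀ a, s.mem a ≤ B

open Classical in
/-- The initial configuration for a graph `G` on `n` vertices and a number `h`: register `0` holds
`n`, register `1` holds `h`, the memory holds the adjacency matrix of `G` row by row, starting at
address `0`, and everything else is zero. -/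
noncomputable def graphInput {n : ℕ} (G : SimpleGraph (Fin n)) (h : ℕ) : Config where
  pc := 0
  reg := fun a => if a = 0 then n else if a = 1 then h else 0
  mem := fun a => if ∃ i j : Fin n, a = i.val * n + j.val ∧ G.Adj i j then 1 else 0

end WordRAM

/-! ### Twins in graphs without an induced path on four vertices -/

section Graph

set_option linter.unusedSectionVars false

variable {V : Type*}

/-! A graph without induced four-vertex paths, or its complement, is disconnected as soon as there
are two vertices (`IsP4Free.splits_or`). Hence every set of at least two vertices contains twins
(`IsP4Free.exists_twins`). So the graph can be shrunk by n − 1 contractions of twins: each surviving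
vertex represents a module, and merging two twin representatives turns their modules into a disjoint
union or a join, according to whether the representatives are adjacent (`IsModularPartition.merge`).

Each module carries a table: for every d, the largest p such that a complete graph on p vertices has
a model in the module with at most d vertices. Keeping track of d is what makes the join tractable.
In a disjoint union a model may be taken on one side, so tables combine by maximum. In a join, any
vertex of S together with any vertex of T is a legitimate bag, so a bag crossing the join need only
consist of two vertices. A model is then a model in S, a model in T and a number c of crossing pairs
(`hasModel_join_of_pairs`, `HasModel.exists_of_join`). With x and y vertices allotted to the sides,
the maximum over c of g₁(x − c) + g₂(y − c) + c obeys a diagonal recursion with constant work per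
entry (`pairTable`), so merging two tables takes quadratic time.

Twins are also found in quadratic time per round, by maintaining for each pair the number of
representatives that distinguish it (`sum_adjDiff_lt_iff`). With n − 1 rounds the total is cubic.

The algorithm is written in a small loop language. A compiler with a simulation theorem
(`Cmd.code_reaches`) carries correctness, time and word size over to the machine. Every loop makes
at most n + 1 iterations and the loops are nested three deep, whence the cubic bound
(`Cmd.cost_le`). -/

/-- Elementwise form of the absence of induced paths on four vertices. -/
def IsP4Free (G : SimpleGraph V) : Prop :=
  ∀ a b c d, G.Adj a b → G.Adj b c → G.Adj c d → ¬ G.Adj a c → ¬ G.Adj b d → ¬ G.Adj a d → False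

/-- The four-vertex path is self-complementary: a, b, c, d is an induced path of the complement
exactly when b, d, a, c is one of the graph. -/
theorem IsP4Free.compl {G : SimpleGraph V} (hG : IsP4Free G) : IsP4Free Gᶜ := by
  intro a b c d hab hbc hcd hac hbd had
  simp only [SimpleGraph.compl_adj, not_and, not_not] at *
  have h1 : b ≠ d := by rintro rfl; exact hab.2 (had hab.1)
  have h2 : a ≠ d := by rintro rfl; exact hcd.2 (hac hcd.1.symm).symm
  have h3 : a ≠ c := by rintro rfl; exact hcd.2 (had hcd.1)
  exact hG b d a c (hbd h1) (had h2).symm (hac h3) (fun h => hab.2 h.symm) (fun h => hcd.2 h.symm)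
    hbc.2

variable [DecidableEq V]

/-- A partition of `S` into two nonempty parts without edges between them. -/
def Splits (G : SimpleGraph V) (S : Finset V) : Prop :=
  ∃ A ⊆ S, A.Nonempty ∧ A ≠ S ∧ ∀ x ∈ A, ∀ y ∈ S, y ∉ A → ¬ G.Adj x y

/-- If v sees all of S, it is isolated in the complement. Otherwise take the component A of a
non-neighbour y of v. Either v has no neighbour in A, or none in S outside A, and the graph still
splits; or some edge of A joins a non-neighbour of v to a neighbour, and together with v and a
neighbour of v outside A it gives an induced path. -/
theorem Splits.insert {G : SimpleGraph V} (hG : IsP4Free G) {S : Finset V} {v : V} (hv : v ∉ S)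
    (hS : Splits G S) : Splits G (insert v S) ∨ Splits Gᶜ (insert v S) := by
  classical
  obtain ⟨A₀, hA₀S, hA₀, hA₀', hA₀e⟩ := hS
  by_cases hall : ∀ y ∈ S, G.Adj v y
  · right
    refine ⟨{v}, by simp, by simp, ?_, ?_⟩
    · intro h
      obtain ⟨a, ha⟩ := hA₀
      have : a ∈ ({v} : Finset V) := h ▸ Finset.mem_insert_of_mem (hA₀S ha)
      exact hv (Finset.mem_singleton.1 this ▸ hA₀S ha)
    · intro x hx y hy hyv
      simp only [Finset.mem_singleton, Finset.mem_insert] at *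
      subst hx
      rcases hy with hy | hy
      · exact absurd hy hyv
      · simp [hall y hy]
  push Not at hall
  obtain ⟨y, hyS, hvy⟩ := hall
  left
  let closed : Finset V → Prop := fun A => A ⊆ S ∧ y ∈ A ∧ A ≠ S ∧
    ∀ x ∈ A, ∀ z ∈ S, z ∉ A → ¬ G.Adj x z
  have hex : ∃ A, closed A := by
    by_cases hyA : y ∈ A₀
    · exact ⟨A₀, hA₀S, hyA, hA₀', hA₀e⟩
    · refine ⟨S \ A₀, Finset.sdiff_subset, Finset.mem_sdiff.2 ⟨hyS, hyA⟩, ?_, ?_⟩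
      · intro h
        obtain ⟨a, ha⟩ := hA₀
        have := h.symm ▸ hA₀S ha
        simp [ha] at this
      · intro x hx z hz hzA hadj
        simp only [Finset.mem_sdiff, not_and, not_not] at *
        exact hA₀e z (hzA hz) x hx.1 hx.2 hadj.symm
  -- Minimality stands in for connectedness: such an A is the component of y in S.
  obtain ⟨A, ⟨hAS, hyA, hAne, hAe⟩, hmin⟩ :=
    WellFounded.has_min (measure (Finset.card (α := V))).wf {A | closed A} hex
  have hvA : v ∉ A := fun h => hv (hAS h)
  by_cases hva : ∀ x ∈ A, ¬ G.Adj v x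
  · refine ⟨A, hAS.trans (Finset.subset_insert _ _), ⟨y, hyA⟩, ?_, ?_⟩
    · rintro h
      exact hvA (h ▸ Finset.mem_insert_self _ _)
    · intro x hx z hz hzA
      rcases Finset.mem_insert.1 hz with rfl | hz
      · exact fun h => hva x hx h.symm
      · exact hAe x hx z hz hzA
  by_cases hvb : ∀ z ∈ S, z ∉ A → ¬ G.Adj v z
  · refine ⟨S \ A, Finset.sdiff_subset.trans (Finset.subset_insert _ _), ?_, ?_, ?_⟩
    · rw [Finset.sdiff_nonempty]
      exact fun h => hAne (hAS.antisymm h)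
    · rintro h
      have : v ∈ S \ A := h ▸ Finset.mem_insert_self _ _
      exact hv (Finset.mem_sdiff.1 this).1
    · intro x hx z hz hzA hadj
      simp only [Finset.mem_sdiff, not_and, not_not] at hx hzA
      rcases Finset.mem_insert.1 hz with rfl | hz
      · exact hvb x hx.1 hx.2 hadj.symm
      · exact hAe z (hzA hz) x hx.1 hx.2 hadj.symm
  push Not at hva hvb
  obtain ⟨x₀, hx₀A, hvx₀⟩ := hva
  obtain ⟨z, hzS, hzA, hvz⟩ := hvb
  exfalso
  -- The non-neighbours of v in A form a smaller set containing y, so an edge must leave it; the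
  -- rest shows that without an induced path none does.
  have hnot : ¬ closed (A.filter fun x => ¬ G.Adj v x) := by
    intro h
    refine hmin _ h (Finset.card_lt_card ?_)
    refine Finset.filter_ssubset.2 ⟨x₀, hx₀A, by simpa using hvx₀⟩
  apply hnot
  refine ⟨(Finset.filter_subset _ _).trans hAS, Finset.mem_filter.2 ⟨hyA, hvy⟩, ?_, ?_⟩
  · intro h
    have := h.symm ▸ hAS hx₀A
    exact (Finset.mem_filter.1 this).2 hvx₀
  · intro y' hy' x hx hxA hadj
    rw [Finset.mem_filter] at hy' hxA
    have hxA' : x ∈ A := by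
      by_contra hxA'
      exact hAe y' hy'.1 x hx hxA' hadj
    have hvx : G.Adj v x := by
      by_contra h
      exact hxA ⟨hxA', h⟩
    exact hG y' x v z hadj hvx.symm hvz (fun h => hy'.2 h.symm) (hAe x hxA' z hzS hzA)
      (hAe y' hy'.1 z hzS hzA)

/-- Vertices are added one at a time; since the hypothesis passes to complements, the case where the
complement splits is the same step applied to the complement. -/
theorem IsP4Free.splits_or {G : SimpleGraph V} (hG : IsP4Free G) (S : Finset V)
    (hS : 2 ≤ S.card) : Splits G S ∨ Splits Gᶜ S := by
  induction S using Finset.induction_on with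
  | empty => simp at hS
  | insert v S hv ih =>
    rw [Finset.card_insert_of_notMem hv] at hS
    by_cases h2 : 2 ≤ S.card
    · rcases ih h2 with h | h
      · exact h.insert hG hv
      · simpa [or_comm] using h.insert hG.compl hv
    · obtain ⟨w, rfl⟩ := Finset.card_eq_one.1 (show S.card = 1 by omega)
      have hvw : v ≠ w := by simpa using hv
      have key : ∀ H : SimpleGraph V, ¬ H.Adj v w → Splits H {v, w} := by
        intro H hH
        refine ⟨{v}, by simp, by simp, ?_, ?_⟩
        · intro h
          have : w ∈ ({v} : Finset V) := h ▸ (by simp)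
          exact hvw (Finset.mem_singleton.1 this).symm
        · intro x hx y hy hyx
          simp only [Finset.mem_singleton, Finset.mem_insert] at *
          subst hx
          rcases hy with rfl | rfl
          · exact absurd rfl hyx
          · exact hH
      by_cases h : G.Adj v w
      · exact Or.inr (key _ (by simp [h]))
      · exact Or.inl (key _ h)

/-- `u` and `v` have the same neighbours in `S` outside `{u, v}`. -/
def TwinsIn (G : SimpleGraph V) (S : Finset V) (u v : V) : Prop :=
  ∀ w ∈ S, w ≠ u → w ≠ v → (G.Adj u w ↔ G.Adj v w)

/-- A split of the graph or of its complement is a cut across which adjacency is constant. Twins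
inside one side therefore remain twins in S, and if both sides are singletons, their two vertices
are twins trivially. -/
theorem IsP4Free.exists_twins {G : SimpleGraph V} (hG : IsP4Free G) (S : Finset V)
    (hS : 2 ≤ S.card) : ∃ u ∈ S, ∃ v ∈ S, u ≠ v ∧ TwinsIn G S u v := by
  induction S using Finset.strongInduction with
  | H S ih =>
    have key : ∃ A ⊆ S, A.Nonempty ∧ A ≠ S ∧
        ∀ x ∈ A, ∀ x' ∈ A, ∀ y ∈ S, ∀ y' ∈ S, y ∉ A → y' ∉ A → (G.Adj x y ↔ G.Adj x' y') := by
      rcases hG.splits_or S hS with ⟨A, h1, h2, h3, h4⟩ | ⟨A, h1, h2, h3, h4⟩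
      · refine ⟨A, h1, h2, h3, fun x hx x' hx' y hy y' hy' hyA hyA' => ?_⟩
        simp [h4 x hx y hy hyA, h4 x' hx' y' hy' hyA']
      · refine ⟨A, h1, h2, h3, fun x hx x' hx' y hy y' hy' hyA hyA' => ?_⟩
        have e1 := h4 x hx y hy hyA
        have e2 := h4 x' hx' y' hy' hyA'
        simp only [SimpleGraph.compl_adj, not_and, not_not] at e1 e2
        simp [e1 (fun h => hyA (h ▸ hx)), e2 (fun h => hyA' (h ▸ hx'))]
    obtain ⟨A, hAS, hA, hAne, hAe⟩ := key
    have hss : A ⊂ S := hAS.ssubset_of_ne hAne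
    have hB : (S \ A).Nonempty := by
      rw [Finset.sdiff_nonempty]
      exact fun h => hAne (hAS.antisymm h)
    by_cases hA2 : 2 ≤ A.card
    · obtain ⟨u, hu, v, hv, huv, ht⟩ := ih A hss hA2
      refine ⟨u, hAS hu, v, hAS hv, huv, fun w hw hwu hwv => ?_⟩
      by_cases hwA : w ∈ A
      · exact ht w hwA hwu hwv
      · exact hAe u hu v hv w hw w hw hwA hwA
    by_cases hB2 : 2 ≤ (S \ A).card
    · obtain ⟨u, hu, v, hv, huv, ht⟩ := ih (S \ A) (Finset.sdiff_ssubset hAS hA) hB2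
      rw [Finset.mem_sdiff] at hu hv
      refine ⟨u, hu.1, v, hv.1, huv, fun w hw hwu hwv => ?_⟩
      by_cases hwA : w ∈ A
      · rw [G.adj_comm u, G.adj_comm v]
        exact hAe w hwA w hwA u hu.1 v hv.1 hu.2 hv.2
      · exact ht w (Finset.mem_sdiff.2 ⟨hw, hwA⟩) hwu hwv
    · obtain ⟨u, rfl⟩ := Finset.card_eq_one.1 (show A.card = 1 by have := hA.card_pos; omega)
      obtain ⟨v, hv⟩ := Finset.card_eq_one.1
        (show (S \ {u}).card = 1 by have := hB.card_pos; omega)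
      have hv' : v ∈ S \ {u} := by simp [hv]
      simp only [Finset.mem_sdiff, Finset.mem_singleton] at hv'
      refine ⟨u, hAS (by simp), v, hv'.1, fun h => hv'.2 h.symm, fun w hw hwu hwv => ?_⟩
      have : w ∈ S \ {u} := by simp [hw, hwu]
      rw [hv, Finset.mem_singleton] at this
      exact absurd this hwv

/-! ### Models of complete graphs with a bounded number of vertices -/

/-- `B` is nonempty and every cut of `B` is crossed by an edge. -/
def ConnOn (G : SimpleGraph V) (B : Finset V) : Prop :=
  B.Nonempty ∧ ∀ X ⊆ B, X.Nonempty → X ≠ B → ∃ x ∈ X, ∃ y ∈ B, y ∉ X ∧ G.Adj x y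

/-- The members of `𝓑` are the bags of a complete minor inside `S`. -/
structure IsCliqueModel (G : SimpleGraph V) (S : Finset V) (𝓑 : Finset (Finset V)) : Prop where
  sub : ∀ B ∈ 𝓑, B ⊆ S
  conn : ∀ B ∈ 𝓑, ConnOn G B
  disj : ∀ B ∈ 𝓑, ∀ C ∈ 𝓑, B ≠ C → Disjoint B C
  touch : ∀ B ∈ 𝓑, ∀ C ∈ 𝓑, B ≠ C → ∃ x ∈ B, ∃ y ∈ C, G.Adj x y

/-- The complete graph on `p` vertices has a model in `S` with at most `d` vertices. -/
def HasModel (G : SimpleGraph V) (S : Finset V) (d p : ℕ) : Prop :=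
  ∃ 𝓑, IsCliqueModel G S 𝓑 ∧ 𝓑.card = p ∧ ∑ B ∈ 𝓑, B.card ≤ d

variable {G : SimpleGraph V} {S T : Finset V}

theorem IsCliqueModel.subset {𝓑 𝓒 : Finset (Finset V)} (h : IsCliqueModel G S 𝓑) (hs : 𝓒 ⊆ 𝓑) :
    IsCliqueModel G S 𝓒 :=
  ⟨fun B hB => h.sub B (hs hB), fun B hB => h.conn B (hs hB),
    fun B hB C hC => h.disj B (hs hB) C (hs hC), fun B hB C hC => h.touch B (hs hB) C (hs hC)⟩

theorem IsCliqueModel.mono {𝓑 : Finset (Finset V)} (h : IsCliqueModel G S 𝓑)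
    (hs : ∀ B ∈ 𝓑, B ⊆ T) : IsCliqueModel G T 𝓑 :=
  ⟨hs, h.conn, h.disj, h.touch⟩

theorem HasModel.mono {d d' p : ℕ} (h : HasModel G S d p) (hd : d ≤ d') : HasModel G S d' p := by
  obtain ⟨𝓑, h1, h2, h3⟩ := h
  exact ⟨𝓑, h1, h2, h3.trans hd⟩

theorem HasModel.anti {d p q : ℕ} (h : HasModel G S d p) (hq : q ≤ p) : HasModel G S d q := by
  obtain ⟨𝓑, h1, h2, h3⟩ := h
  obtain ⟨𝓒, hs, hc⟩ := Finset.exists_subset_card_eq (h2.symm ▸ hq)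
  exact ⟨𝓒, h1.subset hs, hc, (Finset.sum_le_sum_of_subset hs).trans h3⟩

theorem HasModel.le {d p : ℕ} (h : HasModel G S d p) : p ≤ d := by
  obtain ⟨𝓑, h1, h2, h3⟩ := h
  calc p = ∑ _B ∈ 𝓑, 1 := by simp [h2]
    _ ≤ ∑ B ∈ 𝓑, B.card := Finset.sum_le_sum fun B hB => (h1.conn B hB).1.card_pos
    _ ≤ d := h3

theorem hasModel_zero (G : SimpleGraph V) (S : Finset V) (d : ℕ) : HasModel G S d 0 :=
  ⟨∅, ⟨by simp, by simp, by simp, by simp⟩, by simp, by simp⟩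

theorem IsCliqueModel.sum_card_inter_le {𝓑 : Finset (Finset V)} (h : IsCliqueModel G S 𝓑)
    (X : Finset V) : ∑ B ∈ 𝓑, (B ∩ X).card ≤ X.card := by
  rw [← Finset.card_biUnion]
  · exact Finset.card_le_card (Finset.biUnion_subset.2 fun B _ => Finset.inter_subset_right)
  · intro B hB C hC hne
    exact (h.disj B hB C hC hne).mono Finset.inter_subset_left Finset.inter_subset_left

theorem IsCliqueModel.sum_card_le {𝓑 : Finset (Finset V)} (h : IsCliqueModel G S 𝓑) :
    ∑ B ∈ 𝓑, B.card ≤ S.card := by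
  refine le_of_eq_of_le (Finset.sum_congr rfl fun B hB => ?_) (h.sum_card_inter_le S)
  rw [Finset.inter_eq_left.2 (h.sub B hB)]

theorem connOn_singleton (v : V) : ConnOn G {v} := by
  refine ⟨by simp, fun X hX hne hne' => ?_⟩
  rcases Finset.subset_singleton_iff.1 hX with h | h
  · exact absurd h hne.ne_empty
  · exact absurd h hne'

theorem connOn_pair {u v : V} (h : G.Adj u v) : ConnOn G {u, v} := by
  refine ⟨by simp, fun X hX ⟨x, hx⟩ hne => ?_⟩
  by_cases hu : u ∈ X
  · by_cases hv : v ∈ X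
    · exact absurd (hX.antisymm (by simp [Finset.insert_subset_iff, hu, hv])) hne
    · exact ⟨u, hu, v, by simp, hv, h⟩
  · have := hX hx
    simp only [Finset.mem_insert, Finset.mem_singleton] at this
    rcases this with rfl | rfl
    · exact absurd hx hu
    · exact ⟨x, hx, u, by simp, hu, h.symm⟩

theorem hasModel_singleton {v : V} {d p : ℕ} :
    HasModel G {v} d p ↔ p ≤ if 0 < d then 1 else 0 := by
  constructor
  · intro h
    split_ifs with hd
    · obtain ⟨𝓑, h1, h2, h3⟩ := h
      have := h1.sum_card_le
      calc p = ∑ _B ∈ 𝓑, 1 := by simp [h2]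
        _ ≤ ∑ B ∈ 𝓑, B.card := Finset.sum_le_sum fun B hB => (h1.conn B hB).1.card_pos
        _ ≤ 1 := by simpa using this
    · have := h.le
      omega
  · intro h
    split_ifs at h with hd
    · refine HasModel.anti ⟨{{v}}, ⟨?_, ?_, ?_, ?_⟩, by simp, by simp; omega⟩ h
      · simp
      · simpa using connOn_singleton v
      · intro B hB C hC hne
        simp only [Finset.mem_singleton] at hB hC
        exact absurd (hB.trans hC.symm) hne
      · intro B hB C hC hne
        simp only [Finset.mem_singleton] at hB hC
        exact absurd (hB.trans hC.symm) hne
    · obtain rfl : p = 0 := by omega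
      exact hasModel_zero _ _ _

/-! ### Models in disjoint unions and in joins -/

theorem ConnOn.subset_or_subset {B : Finset V} (hB : ConnOn G B) (hsub : B ⊆ S ∪ T)
    (he : ∀ a ∈ S, ∀ b ∈ T, ¬ G.Adj a b) : B ⊆ S ∨ B ⊆ T := by
  by_contra! hcon
  obtain ⟨x, hx, hxS⟩ := Finset.not_subset.1 hcon.1
  obtain ⟨y, hy, hyT⟩ := Finset.not_subset.1 hcon.2
  have hyS : y ∈ S := (Finset.mem_union.1 (hsub hy)).resolve_right hyT
  obtain ⟨a, ha, b, hb, hba, hab⟩ := hB.2 (B ∩ S) Finset.inter_subset_left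
    ⟨y, Finset.mem_inter.2 ⟨hy, hyS⟩⟩
    (fun h => hxS (Finset.mem_inter.1 (h.symm ▸ hx)).2)
  have hbS : b ∉ S := fun h => hba (Finset.mem_inter.2 ⟨hb, h⟩)
  exact he a (Finset.mem_inter.1 ha).2 b ((Finset.mem_union.1 (hsub hb)).resolve_left hbS) hab

/-- A connected bag cannot meet both sides, and two touching bags lie on the same side, so a whole
model lives in S or in T. -/
theorem hasModel_union_of_anticomplete
    (he : ∀ a ∈ S, ∀ b ∈ T, ¬ G.Adj a b) {d p : ℕ} :
    HasModel G (S ∪ T) d p ↔ HasModel G S d p ∨ HasModel G T d p := by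
  constructor
  · rintro ⟨𝓑, h1, h2, h3⟩
    rcases 𝓑.eq_empty_or_nonempty with rfl | ⟨B, hB⟩
    · obtain rfl : p = 0 := by simpa using h2.symm
      exact Or.inl (hasModel_zero _ _ _)
    have hor : ∀ C ∈ 𝓑, C ⊆ S ∨ C ⊆ T := fun C hC =>
      (h1.conn C hC).subset_or_subset (h1.sub C hC) he
    rcases hor B hB with hBS | hBT
    · left
      refine ⟨𝓑, h1.mono fun C hC => ?_, h2, h3⟩
      by_cases hCB : B = C
      · exact hCB ▸ hBS
      · obtain ⟨x, hx, y, hy, hxy⟩ := h1.touch B hB C hC hCB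
        exact (hor C hC).resolve_right fun h => he x (hBS hx) y (h hy) hxy
    · right
      refine ⟨𝓑, h1.mono fun C hC => ?_, h2, h3⟩
      by_cases hCB : B = C
      · exact hCB ▸ hBT
      · obtain ⟨x, hx, y, hy, hxy⟩ := h1.touch B hB C hC hCB
        exact (hor C hC).resolve_left fun h => he y (h hy) x (hBT hx) hxy.symm
  · rintro (⟨𝓑, h1, h2, h3⟩ | ⟨𝓑, h1, h2, h3⟩)
    · exact ⟨𝓑, h1.mono fun B hB => (h1.sub B hB).trans Finset.subset_union_left, h2, h3⟩
    · exact ⟨𝓑, h1.mono fun B hB => (h1.sub B hB).trans Finset.subset_union_right, h2, h3⟩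

/-- In a join, unused vertices of both sides form a further bag. -/
theorem IsCliqueModel.insert_pair {𝓑 : Finset (Finset V)} (h : IsCliqueModel G (S ∪ T) 𝓑)
    (he : ∀ a ∈ S, ∀ b ∈ T, G.Adj a b) {u v : V} (hu : u ∈ S) (hv : v ∈ T)
    (hu' : ∀ B ∈ 𝓑, u ∉ B) (hv' : ∀ B ∈ 𝓑, v ∉ B) :
    IsCliqueModel G (S ∪ T) (insert {u, v} 𝓑) := by
  have hdis : ∀ B ∈ 𝓑, Disjoint {u, v} B := fun B hB => by
    simp [Finset.disjoint_insert_left, hu' B hB, hv' B hB]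
  have htou : ∀ B ∈ 𝓑, ∃ x ∈ ({u, v} : Finset V), ∃ y ∈ B, G.Adj x y := fun B hB => by
    obtain ⟨y, hy⟩ := (h.conn B hB).1
    rcases Finset.mem_union.1 (h.sub B hB hy) with hyS | hyT
    · exact ⟨v, by simp, y, hy, (he y hyS v hv).symm⟩
    · exact ⟨u, by simp, y, hy, he u hu y hyT⟩
  refine ⟨?_, ?_, ?_, ?_⟩
  · rw [Finset.forall_mem_insert]
    refine ⟨?_, h.sub⟩
    simp [Finset.insert_subset_iff, hu, hv]
  · rw [Finset.forall_mem_insert]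
    exact ⟨connOn_pair (he u hu v hv), h.conn⟩
  · intro B hB C hC hne
    rcases Finset.mem_insert.1 hB with rfl | hB <;> rcases Finset.mem_insert.1 hC with rfl | hC
    · exact absurd rfl hne
    · exact hdis C hC
    · exact (hdis B hB).symm
    · exact h.disj B hB C hC hne
  · intro B hB C hC hne
    rcases Finset.mem_insert.1 hB with rfl | hB <;> rcases Finset.mem_insert.1 hC with rfl | hC
    · exact absurd rfl hne
    · exact htou C hC
    · obtain ⟨x, hx, y, hy, hxy⟩ := htou B hB
      exact ⟨y, hy, x, hx, hxy.symm⟩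
    · exact h.touch B hB C hC hne

theorem IsCliqueModel.union {𝓑 𝓒 : Finset (Finset V)} (h : IsCliqueModel G S 𝓑)
    (h' : IsCliqueModel G T 𝓒) (hST : Disjoint S T) (he : ∀ a ∈ S, ∀ b ∈ T, G.Adj a b) :
    IsCliqueModel G (S ∪ T) (𝓑 ∪ 𝓒) := by
  have htou : ∀ B ∈ 𝓑, ∀ C ∈ 𝓒, ∃ x ∈ B, ∃ y ∈ C, G.Adj x y := fun B hB C hC => by
    obtain ⟨x, hx⟩ := (h.conn B hB).1
    obtain ⟨y, hy⟩ := (h'.conn C hC).1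
    exact ⟨x, hx, y, hy, he x (h.sub B hB hx) y (h'.sub C hC hy)⟩
  have hdis : ∀ B ∈ 𝓑, ∀ C ∈ 𝓒, Disjoint B C := fun B hB C hC =>
    hST.mono (h.sub B hB) (h'.sub C hC)
  refine ⟨?_, ?_, ?_, ?_⟩
  · intro B hB
    rcases Finset.mem_union.1 hB with hB | hB
    · exact (h.sub B hB).trans Finset.subset_union_left
    · exact (h'.sub B hB).trans Finset.subset_union_right
  · intro B hB
    rcases Finset.mem_union.1 hB with hB | hB
    · exact h.conn B hB
    · exact h'.conn B hB
  · intro B hB C hC hne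
    rcases Finset.mem_union.1 hB with hB | hB <;> rcases Finset.mem_union.1 hC with hC | hC
    · exact h.disj B hB C hC hne
    · exact hdis B hB C hC
    · exact (hdis C hC B hB).symm
    · exact h'.disj B hB C hC hne
  · intro B hB C hC hne
    rcases Finset.mem_union.1 hB with hB | hB <;> rcases Finset.mem_union.1 hC with hC | hC
    · exact h.touch B hB C hC hne
    · exact htou B hB C hC
    · obtain ⟨x, hx, y, hy, hxy⟩ := htou C hC B hB
      exact ⟨y, hy, x, hx, hxy.symm⟩
    · exact h'.touch B hB C hC hne

theorem exists_unused {𝓑 : Finset (Finset V)} {X : Finset V}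
    (hlt : ∑ B ∈ 𝓑, (B ∩ X).card < X.card) : ∃ u ∈ X, ∀ B ∈ 𝓑, u ∉ B := by
  by_contra! hcon
  refine absurd hlt (not_lt.2 ?_)
  refine le_trans (Finset.card_le_card (t := 𝓑.biUnion fun B => B ∩ X) ?_) Finset.card_biUnion_le
  intro x hx
  obtain ⟨B, hB, hxB⟩ := hcon x hx
  exact Finset.mem_biUnion.2 ⟨B, hB, Finset.mem_inter.2 ⟨hxB, hx⟩⟩

/-- Across a join the two models touch automatically. As long as both sides have an unused vertex,
these two form one more bag, and that bag touches every other one. -/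
theorem hasModel_join_of_pairs (hST : Disjoint S T) (he : ∀ a ∈ S, ∀ b ∈ T, G.Adj a b)
    {x y a b c : ℕ} (hS : HasModel G S x a) (hT : HasModel G T y b) (hx : x + c ≤ S.card)
    (hy : y + c ≤ T.card) : HasModel G (S ∪ T) (x + y + 2 * c) (a + b + c) := by
  obtain ⟨𝓑, hB, hBc, hBs⟩ := hS
  obtain ⟨𝓒, hC, hCc, hCs⟩ := hT
  have hd : Disjoint 𝓑 𝓒 := by
    rw [Finset.disjoint_left]
    intro B h1 h2
    obtain ⟨z, hz⟩ := (hB.conn B h1).1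
    exact Finset.disjoint_left.1 hST (hB.sub B h1 hz) (hC.sub B h2 hz)
  -- Usage is counted separately in S and in T, since an unused vertex is needed on each side.
  have key : ∃ 𝓓, IsCliqueModel G (S ∪ T) 𝓓 ∧ 𝓓.card = a + b + c ∧
      ∑ B ∈ 𝓓, (B ∩ S).card ≤ x + c ∧ ∑ B ∈ 𝓓, (B ∩ T).card ≤ y + c := by
    induction c with
    | zero =>
      refine ⟨𝓑 ∪ 𝓒, hB.union hC hST he, by rw [Finset.card_union_of_disjoint hd, hBc, hCc]; rfl,
        ?_, ?_⟩
      · rw [Finset.sum_union hd]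
        have h1 : ∑ B ∈ 𝓑, (B ∩ S).card ≤ x :=
          (Finset.sum_le_sum fun B _ => Finset.card_le_card Finset.inter_subset_left).trans hBs
        have h2 : ∑ B ∈ 𝓒, (B ∩ S).card = 0 := Finset.sum_eq_zero fun B h => by
          rw [Finset.card_eq_zero, ← Finset.disjoint_iff_inter_eq_empty]
          exact hST.symm.mono_left (hC.sub B h)
        omega
      · rw [Finset.sum_union hd]
        have h1 : ∑ B ∈ 𝓒, (B ∩ T).card ≤ y :=
          (Finset.sum_le_sum fun B _ => Finset.card_le_card Finset.inter_subset_left).trans hCs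
        have h2 : ∑ B ∈ 𝓑, (B ∩ T).card = 0 := Finset.sum_eq_zero fun B h => by
          rw [Finset.card_eq_zero, ← Finset.disjoint_iff_inter_eq_empty]
          exact hST.mono_left (hB.sub B h)
        omega
    | succ c ih =>
      obtain ⟨𝓓, h1, h2, h3, h4⟩ := ih (by omega) (by omega)
      obtain ⟨u, hu, hu'⟩ := exists_unused (𝓑 := 𝓓) (X := S) (by omega)
      obtain ⟨v, hv, hv'⟩ := exists_unused (𝓑 := 𝓓) (X := T) (by omega)
      have hnew : ({u, v} : Finset V) ∉ 𝓓 := fun h => hu' _ h (by simp)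
      have huT : u ∉ T := Finset.disjoint_left.1 hST hu
      have hvS : v ∉ S := Finset.disjoint_right.1 hST hv
      refine ⟨insert {u, v} 𝓓, h1.insert_pair he hu hv hu' hv', ?_, ?_, ?_⟩
      · rw [Finset.card_insert_of_notMem hnew]
        omega
      · rw [Finset.sum_insert hnew, Finset.insert_inter_of_mem hu,
          Finset.singleton_inter_of_notMem hvS]
        simp
        omega
      · rw [Finset.sum_insert hnew, Finset.insert_inter_of_notMem huT,
          Finset.singleton_inter_of_mem hv]
        simp
        omega
  obtain ⟨𝓓, h1, h2, h3, h4⟩ := key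
  refine ⟨𝓓, h1, h2, ?_⟩
  have : ∑ B ∈ 𝓓, B.card = ∑ B ∈ 𝓓, (B ∩ S).card + ∑ B ∈ 𝓓, (B ∩ T).card := by
    rw [← Finset.sum_add_distrib]
    refine Finset.sum_congr rfl fun B h => ?_
    rw [← Finset.card_union_of_disjoint (hST.mono Finset.inter_subset_right
      Finset.inter_subset_right), ← Finset.inter_union_distrib_left,
      Finset.inter_eq_left.2 (h1.sub B h)]
  omega

/-- The bags are sorted into those inside S, those inside T and the rest. Each of the rest uses a
vertex on either side, so replacing it by a crossing pair never needs more room. -/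
theorem HasModel.exists_of_join (hST : Disjoint S T) {d p : ℕ} (h : HasModel G (S ∪ T) d p) :
    ∃ x y a b c, HasModel G S x a ∧ HasModel G T y b ∧ x + c ≤ S.card ∧ y + c ≤ T.card ∧
      x + y + 2 * c ≤ d ∧ p = a + b + c := by
  obtain ⟨𝓑, h1, h2, h3⟩ := h
  set 𝓢 := 𝓑.filter (· ⊆ S) with h𝓢
  set 𝓡 := 𝓑.filter (¬ · ⊆ S) with h𝓡
  set 𝓣 := 𝓡.filter (· ⊆ T) with h𝓣
  set 𝓒 := 𝓡.filter (¬ · ⊆ T) with h𝓒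
  have hR : 𝓡 ⊆ 𝓑 := Finset.filter_subset _ _
  have hTs : 𝓣 ⊆ 𝓑 := (Finset.filter_subset _ _).trans hR
  have split : ∀ f : Finset V → ℕ, ∑ B ∈ 𝓑, f B = ∑ B ∈ 𝓢, f B + (∑ B ∈ 𝓣, f B + ∑ B ∈ 𝓒, f B) := by
    intro f
    rw [h𝓣, h𝓒, Finset.sum_filter_add_sum_filter_not, h𝓢, h𝓡, Finset.sum_filter_add_sum_filter_not]
  have hcr : ∀ B ∈ 𝓒, 1 ≤ (B ∩ S).card ∧ 1 ≤ (B ∩ T).card := by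
    intro B hB
    simp only [h𝓒, h𝓡, Finset.mem_filter] at hB
    obtain ⟨⟨hB, hBS⟩, hBT⟩ := hB
    obtain ⟨y, hy, hyS⟩ := Finset.not_subset.1 hBS
    obtain ⟨x, hx, hxT⟩ := Finset.not_subset.1 hBT
    have hyT := (Finset.mem_union.1 (h1.sub B hB hy)).resolve_left hyS
    have hxS := (Finset.mem_union.1 (h1.sub B hB hx)).resolve_right hxT
    exact ⟨Finset.card_pos.2 ⟨x, Finset.mem_inter.2 ⟨hx, hxS⟩⟩,
      Finset.card_pos.2 ⟨y, Finset.mem_inter.2 ⟨hy, hyT⟩⟩⟩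
  have c1 : 𝓒.card ≤ ∑ B ∈ 𝓒, (B ∩ S).card := by
    simpa using Finset.sum_le_sum (f := fun _ => 1) fun B hB => (hcr B hB).1
  have c2 : 𝓒.card ≤ ∑ B ∈ 𝓒, (B ∩ T).card := by
    simpa using Finset.sum_le_sum (f := fun _ => 1) fun B hB => (hcr B hB).2
  have c3 : 𝓒.card * 2 ≤ ∑ B ∈ 𝓒, B.card := by
    rw [← smul_eq_mul, ← Finset.sum_const]
    refine Finset.sum_le_sum fun B hB => ?_
    have hc := hcr B hB
    have := Finset.card_le_card (Finset.union_subset (Finset.inter_subset_left (s₁ := B) (s₂ := S))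
      (Finset.inter_subset_left (s₁ := B) (s₂ := T)))
    rw [Finset.card_union_of_disjoint (hST.mono Finset.inter_subset_right
      Finset.inter_subset_right)] at this
    omega
  have s1 : ∑ B ∈ 𝓢, B.card = ∑ B ∈ 𝓢, (B ∩ S).card := Finset.sum_congr rfl fun B hB => by
    rw [Finset.inter_eq_left.2 (Finset.mem_filter.1 hB).2]
  have s2 : ∑ B ∈ 𝓣, B.card = ∑ B ∈ 𝓣, (B ∩ T).card := Finset.sum_congr rfl fun B hB => by
    rw [Finset.inter_eq_left.2 (Finset.mem_filter.1 hB).2]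
  have t1 := h1.sum_card_inter_le S
  have t2 := h1.sum_card_inter_le T
  have t3 := h3
  have t4 := split fun _ => 1
  rw [split] at t1 t2 t3
  simp only [Finset.sum_const, smul_eq_mul, mul_one] at t4
  refine ⟨∑ B ∈ 𝓢, B.card, ∑ B ∈ 𝓣, B.card, 𝓢.card, 𝓣.card, 𝓒.card,
    ⟨𝓢, (h1.subset (Finset.filter_subset _ _)).mono fun B hB => (Finset.mem_filter.1 hB).2, rfl,
      le_rfl⟩,
    ⟨𝓣, (h1.subset hTs).mono fun B hB => (Finset.mem_filter.1 hB).2, rfl, le_rfl⟩, ?_, ?_, ?_, ?_⟩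
  all_goals omega

/-! ### Recursion for tables -/

/-- `g d` is the largest order of a complete minor in `S` with at most `d` vertices. -/
def IsTable (G : SimpleGraph V) (S : Finset V) (m : ℕ) (g : ℕ → ℕ) : Prop :=
  ∀ d ≤ m, ∀ p, HasModel G S d p ↔ p ≤ g d

theorem IsTable.le_self {m : ℕ} {g : ℕ → ℕ} (h : IsTable G S m g) {d : ℕ} (hd : d ≤ m) :
    g d ≤ d :=
  ((h d hd _).2 le_rfl).le

/-- The largest number of bags with `x` vertices in one side and `y` vertices in the other. -/
def pairTable (g₁ g₂ : ℕ → ℕ) : ℕ → ℕ → ℕ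
  | x + 1, y + 1 => max (g₁ (x + 1) + g₂ (y + 1)) (pairTable g₁ g₂ x y + 1)
  | x, y => g₁ x + g₂ y

/-- Together with `exists_pairTable_eq` this identifies the diagonal recursion with the maximum over
the number c of crossing pairs. -/
theorem le_pairTable (g₁ g₂ : ℕ → ℕ) (x y c : ℕ) :
    g₁ x + g₂ y + c ≤ pairTable g₁ g₂ (x + c) (y + c) := by
  induction c with
  | zero =>
    rcases x with _ | x <;> rcases y with _ | y <;> simp [pairTable]
  | succ c ih =>
    rw [← add_assoc x, ← add_assoc y, pairTable]
    omega

theorem exists_pairTable_eq (g₁ g₂ : ℕ → ℕ) (x y : ℕ) :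
    ∃ x' y' c, x = x' + c ∧ y = y' + c ∧ pairTable g₁ g₂ x y = g₁ x' + g₂ y' + c := by
  induction x generalizing y with
  | zero => exact ⟨0, y, 0, rfl, rfl, by simp [pairTable]⟩
  | succ x ih =>
    cases y with
    | zero => exact ⟨x + 1, 0, 0, rfl, rfl, by simp [pairTable]⟩
    | succ y =>
      rcases le_total (g₁ (x + 1) + g₂ (y + 1)) (pairTable g₁ g₂ x y + 1) with h | h
      · obtain ⟨x', y', c, rfl, rfl, h'⟩ := ih y
        exact ⟨x', y', c + 1, rfl, rfl, by rw [pairTable, max_eq_right h, h']; ring⟩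
      · exact ⟨x + 1, y + 1, 0, rfl, rfl, by rw [pairTable, max_eq_left h]; rfl⟩

theorem isTable_singleton (v : V) (m : ℕ) :
    IsTable G {v} m fun d => if 0 < d then 1 else 0 :=
  fun _ _ _ => hasModel_singleton

theorem IsTable.union {m : ℕ} {g₁ g₂ : ℕ → ℕ} (h₁ : IsTable G S m g₁) (h₂ : IsTable G T m g₂)
    (he : ∀ a ∈ S, ∀ b ∈ T, ¬ G.Adj a b) :
    IsTable G (S ∪ T) m fun d => max (g₁ d) (g₂ d) := by
  intro d hd p
  rw [hasModel_union_of_anticomplete he, h₁ d hd, h₂ d hd, le_max_iff]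

/-- In `hg`, x and y count all vertices used on the two sides, including those in crossing pairs;
this is why they are bounded by the sizes of S and T. The alternative p = 0 matches an accumulator
that starts at zero. -/
theorem IsTable.join {m : ℕ} {g₁ g₂ g : ℕ → ℕ} (h₁ : IsTable G S m g₁) (h₂ : IsTable G T m g₂)
    (hST : Disjoint S T) (he : ∀ a ∈ S, ∀ b ∈ T, G.Adj a b)
    (hg : ∀ d ≤ m, ∀ p, p ≤ g d ↔ p = 0 ∨ ∃ x y, x ≤ S.card ∧ y ≤ T.card ∧ x + y ≤ d ∧
      p ≤ pairTable g₁ g₂ x y) :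
    IsTable G (S ∪ T) m g := by
  intro d hd p
  rw [hg d hd]
  constructor
  · intro h
    obtain ⟨x, y, a, b, c, ha, hb, hx, hy, hxy, rfl⟩ := h.exists_of_join hST
    refine Or.inr ⟨x + c, y + c, hx, hy, by omega, ?_⟩
    have := le_pairTable g₁ g₂ x y c
    have := (h₁ x (by omega) a).1 ha
    have := (h₂ y (by omega) b).1 hb
    omega
  · rintro (rfl | ⟨x, y, hx, hy, hxy, hp⟩)
    · exact hasModel_zero _ _ _
    · obtain ⟨x', y', c, rfl, rfl, h⟩ := exists_pairTable_eq g₁ g₂ x y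
      rw [h] at hp
      refine HasModel.anti (HasModel.mono (hasModel_join_of_pairs hST he
        ((h₁ x' (by omega) _).2 le_rfl) ((h₂ y' (by omega) _).2 le_rfl) hx hy) ?_) hp
      omega

/-- Needed only to bound the words that occur while the table is filled. -/
theorem pairTable_le {m : ℕ} {g₁ g₂ : ℕ → ℕ} (h₁ : ∀ d ≤ m, g₁ d ≤ d) (h₂ : ∀ d ≤ m, g₂ d ≤ d)
    {x y : ℕ} (hx : x ≤ m) (hy : y ≤ m) : pairTable g₁ g₂ x y ≤ x + y := by
  obtain ⟨x', y', c, rfl, rfl, h⟩ := exists_pairTable_eq g₁ g₂ x y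
  have := h₁ x' (by omega)
  have := h₂ y' (by omega)
  omega

end Graph

/-! ### A structured language on top of the random access machine

Variables are the registers below `16`; the registers from `16` on are scratch space for the
evaluation of expressions. Register `0` holds the size `n` and is never assigned. The memory is
divided into arrays: array `0` is the input matrix with rows of length `n`, the other arrays
have rows of length `n + 1`. -/

namespace WordRAM

/-- The address of entry `(i, j)` of array `k`. -/
def addr (n k i j : ℕ) : ℕ :=
  if k = 0 then i * n + j else (k * (n + 1) + i) * (n + 1) + j

/-- The indices for which array `k` has an entry. -/
def InRange (n k i j : ℕ) : Prop :=
  if k = 0 then i < n ∧ j < n else i < n + 1 ∧ j < n + 1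

theorem mul_add_inj {N a b i j : ℕ} (hi : i < N) (hj : j < N) (h : a * N + i = b * N + j) :
    a = b ∧ i = j := by
  have hN : 0 < N := by omega
  have h1 : (a * N + i) / N = a := by
    rw [add_comm, Nat.add_mul_div_right _ _ hN, Nat.div_eq_of_lt hi, zero_add]
  have h2 : (b * N + j) / N = b := by
    rw [add_comm, Nat.add_mul_div_right _ _ hN, Nat.div_eq_of_lt hj, zero_add]
  have : a = b := by rw [← h1, ← h2, h]
  subst this
  exact ⟨rfl, by omega⟩

theorem addr_zero_lt {n i j : ℕ} (hi : i < n) (hj : j < n) : i * n + j < n * n := by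
  nlinarith [Nat.mul_le_mul_right n (show i + 1 ≤ n from hi)]

theorem sq_le_addr {n k : ℕ} (hk : k ≠ 0) (i j : ℕ) : n * n ≤ addr n k i j := by
  rw [addr, if_neg hk]
  have : 1 ≤ k := by omega
  nlinarith [Nat.mul_le_mul this (le_refl ((n + 1) * (n + 1)))]

/-- Distinct entries occupy distinct cells, so a store changes one abstract entry only. Array 0 ends
before address n², and every other array starts beyond it. -/
theorem addr_inj {n k i j k' i' j' : ℕ} (h : InRange n k i j) (h' : InRange n k' i' j')
    (he : addr n k i j = addr n k' i' j') : k = k' ∧ i = i' ∧ j = j' := by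
  by_cases hk : k = 0 <;> by_cases hk' : k' = 0
  · simp only [InRange, addr, hk, hk', if_true] at *
    exact ⟨trivial, mul_add_inj h.2 h'.2 he⟩
  · exfalso
    have := sq_le_addr hk' i' j' (n := n)
    simp only [InRange, addr, hk, if_true] at *
    have := addr_zero_lt h.1 h.2
    omega
  · exfalso
    have := sq_le_addr hk i j (n := n)
    simp only [InRange, addr, hk', if_true] at *
    have := addr_zero_lt h'.1 h'.2
    omega
  · simp only [InRange, addr, hk, hk', if_false] at *
    obtain ⟨h1, h2⟩ := mul_add_inj h.2 h'.2 he
    obtain ⟨h3, h4⟩ := mul_add_inj h.1 h'.1 h1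
    exact ⟨h3, h4, h2⟩

/-! ### Syntax and semantics of the loop language -/

inductive Expr : Type
  | lit (c : ℕ)
  | var (r : ℕ)
  | add (e f : Expr)
  | sub (e f : Expr)
  | ld (k : ℕ) (e f : Expr)

inductive Cmd : Type
  | skip
  | seq (c d : Cmd)
  | assign (r : ℕ) (e : Expr)
  | store (k : ℕ) (e f g : Expr)
  | ite (e f : Expr) (c d : Cmd)
  | loop (i b : ℕ) (c : Cmd)

/-- Variables and arrays. -/
structure St : Type where
  v : ℕ → ℕ
  a : ℕ → ℕ → ℕ → ℕ

@[simp] def Expr.eval (s : St) : Expr → ℕ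
  | lit c => c
  | var r => s.v r
  | add e f => e.eval s + f.eval s
  | sub e f => e.eval s - f.eval s
  | ld k e f => s.a k (e.eval s) (f.eval s)

/-- All intermediate values are at most `B` and all indices are in range. -/
@[simp] def Expr.Ok (n B : ℕ) (s : St) : Expr → Prop
  | lit c => c ≤ B
  | var _ => True
  | add e f => e.Ok n B s ∧ f.Ok n B s ∧ e.eval s + f.eval s ≤ B
  | sub e f => e.Ok n B s ∧ f.Ok n B s
  | ld k e f => e.Ok n B s ∧ f.Ok n B s ∧ InRange n k (e.eval s) (f.eval s)

def St.setVar (s : St) (r x : ℕ) : St := ⟨Function.update s.v r x, s.a⟩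

def St.setArr (s : St) (k i j x : ℕ) : St :=
  ⟨s.v, fun k' i' j' => if k' = k ∧ i' = i ∧ j' = j then x else s.a k' i' j'⟩

def iter (f : ℕ → St → St) : ℕ → St → St
  | 0, s => s
  | m + 1, s => f m (iter f m s)

/-- A loop reads its bound on entry and leaves its counter equal to that bound, just as the compiled
test-and-increment code does. -/
def Cmd.eval : Cmd → St → St
  | skip, s => s
  | seq c d, s => d.eval (c.eval s)
  | assign r e, s => s.setVar r (e.eval s)
  | store k e f g, s => s.setArr k (e.eval s) (f.eval s) (g.eval s)
  | ite e f c d, s => if e.eval s < f.eval s then c.eval s else d.eval s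
  | loop i b c, s => (iter (fun j t => c.eval (t.setVar i j)) (s.v b) s).setVar i (s.v b)

/-- The demand that loop bounds be at most n + 1 is what later turns nesting depth into running
time. -/
def Cmd.Ok (n B : ℕ) : Cmd → St → Prop
  | skip, _ => True
  | seq c d, s => c.Ok n B s ∧ d.Ok n B (c.eval s)
  | assign _ e, s => e.Ok n B s
  | store k e f g, s => e.Ok n B s ∧ f.Ok n B s ∧ g.Ok n B s ∧ InRange n k (e.eval s) (f.eval s)
  | ite e f c d, s => e.Ok n B s ∧ f.Ok n B s ∧
      if e.eval s < f.eval s then c.Ok n B s else d.Ok n B s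
  | loop i b c, s => s.v b ≤ n + 1 ∧
      ∀ m < s.v b, c.Ok n B ((iter (fun j t => c.eval (t.setVar i j)) m s).setVar i m)

/-- `c` does not assign variable `r`. -/
def Cmd.keepsVar (r : ℕ) : Cmd → Bool
  | skip => true
  | seq c d => c.keepsVar r && d.keepsVar r
  | assign r' _ => r' != r
  | store _ _ _ _ => true
  | ite _ _ c d => c.keepsVar r && d.keepsVar r
  | loop i _ c => i != r && c.keepsVar r

/-- `c` does not store into array `k`. -/
def Cmd.keepsArr (k : ℕ) : Cmd → Bool
  | skip => true
  | seq c d => c.keepsArr k && d.keepsArr k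
  | assign _ _ => true
  | store k' _ _ _ => k' != k
  | ite _ _ c d => c.keepsArr k && d.keepsArr k
  | loop _ _ c => c.keepsArr k

@[simp] theorem St.setVar_a (s : St) (r x : ℕ) : (s.setVar r x).a = s.a := rfl

@[simp] theorem St.setArr_v (s : St) (k i j x : ℕ) : (s.setArr k i j x).v = s.v := rfl

theorem St.setVar_v (s : St) (r x r' : ℕ) :
    (s.setVar r x).v r' = if r' = r then x else s.v r' := Function.update_apply ..

theorem St.setArr_a (s : St) (k i j x k' i' j' : ℕ) :
    (s.setArr k i j x).a k' i' j' = if k' = k ∧ i' = i ∧ j' = j then x else s.a k' i' j' := rfl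

theorem Cmd.eval_v_of_keepsVar {r : ℕ} (c : Cmd) (h : c.keepsVar r = true) (s : St) :
    (c.eval s).v r = s.v r := by
  induction c generalizing s with
  | skip => rfl
  | seq c d ihc ihd =>
    simp only [keepsVar, Bool.and_eq_true] at h
    rw [eval, ihd h.2, ihc h.1]
  | assign r' e =>
    simp only [keepsVar, bne_iff_ne] at h
    rw [eval, St.setVar_v, if_neg h.symm]
  | store => rfl
  | ite e f c d ihc ihd =>
    simp only [keepsVar, Bool.and_eq_true] at h
    rw [eval]
    split_ifs
    · exact ihc h.1 s
    · exact ihd h.2 s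
  | loop i b c ih =>
    simp only [keepsVar, Bool.and_eq_true, bne_iff_ne] at h
    rw [eval, St.setVar_v, if_neg h.1.symm]
    generalize s.v b = m
    induction m with
    | zero => rfl
    | succ m ihm => rw [iter, ih h.2, St.setVar_v, if_neg h.1.symm, ihm]

theorem Cmd.eval_a_of_keepsArr {k : ℕ} (c : Cmd) (h : c.keepsArr k = true) (s : St) :
    (c.eval s).a k = s.a k := by
  induction c generalizing s with
  | skip => rfl
  | seq c d ihc ihd =>
    simp only [keepsArr, Bool.and_eq_true] at h
    rw [eval, ihd h.2, ihc h.1]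
  | assign r' e => rfl
  | store k' e f g =>
    simp only [keepsArr, bne_iff_ne] at h
    funext i j
    rw [eval, St.setArr_a, if_neg fun h' => h h'.1.symm]
  | ite e f c d ihc ihd =>
    simp only [keepsArr, Bool.and_eq_true] at h
    rw [eval]
    split_ifs
    · exact ihc h.1 s
    · exact ihd h.2 s
  | loop i b c ih =>
    rw [eval, St.setVar_a]
    generalize s.v b = m
    induction m with
    | zero => rfl
    | succ m ihm => rw [iter, ih h, St.setVar_a, ihm]

/-! ### Compilation -/

/-- The address of entry `(R d, R (d + 1))` of array `k`, computed into register `d`. -/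
def addrCode (d k : ℕ) : List Instr :=
  if k = 0 then [.mul d d 0, .add d d (d + 1)]
  else [.const (d + 2) 1, .add (d + 2) (d + 2) 0, .const (d + 3) k, .mul (d + 3) (d + 3) (d + 2),
    .add d d (d + 3), .mul d d (d + 2), .add d d (d + 1)]

/-- Code that evaluates an expression into register `d`. -/
def Expr.code : Expr → ℕ → List Instr
  | lit c, d => [.const d c]
  | var r, d => [.move d r]
  | add e f, d => e.code d ++ f.code (d + 1) ++ [.add d d (d + 1)]
  | sub e f, d => e.code d ++ f.code (d + 1) ++ [.sub d d (d + 1)]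
  | ld k e f, d => e.code d ++ f.code (d + 1) ++ addrCode d k ++ [.load d d]

def Cmd.len : Cmd → ℕ
  | skip => 0
  | seq c d => c.len + d.len
  | assign _ e => (e.code 16).length + 1
  | store k e f g => (e.code 16 ++ f.code 17 ++ addrCode 16 k ++ g.code 17).length + 1
  | ite e f c d => (e.code 16 ++ f.code 17).length + 1 + d.len + 1 + c.len
  | loop _ _ c => 3 + c.len + 3

/-- The code of a command, placed at instruction number `o`. -/
def Cmd.code : Cmd → ℕ → List Instr
  | skip, _ => []
  | seq c d, o => c.code o ++ d.code (o + c.len)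
  | assign r e, _ => e.code 16 ++ [.move r 16]
  | store k e f g, _ => e.code 16 ++ f.code 17 ++ addrCode 16 k ++ g.code 17 ++ [.store 16 17]
  | ite e f c d, o =>
    let l := (e.code 16 ++ f.code 17).length
    e.code 16 ++ f.code 17 ++ [.jumpLt 16 17 (o + l + 1 + d.len + 1)] ++ d.code (o + l + 1) ++
      [.jump (o + l + 1 + d.len + 1 + c.len)] ++ c.code (o + l + 1 + d.len + 1)
  | loop i b c, o =>
    [.const i 0, .jumpLt i b (o + 3), .jump (o + 3 + c.len + 3)] ++ c.code (o + 3) ++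
      [.const 16 1, .add i i 16, .jump (o + 1)]

end WordRAM

/-! ### Well-formedness and running time of commands -/

namespace WordRAM

def Expr.Wf : Expr → Bool
  | .lit _ => true
  | .var r => r < 16
  | .add e f => e.Wf && f.Wf
  | .sub e f => e.Wf && f.Wf
  | .ld k e f => e.Wf && f.Wf && k < 10

/-- Register 0 must keep n for the address computations. A loop body may write neither the counter
nor the bound, so the repeated test of the compiled code agrees with the semantics. -/
def Cmd.Wf : Cmd → Bool
  | .skip => true
  | .seq c d => c.Wf && d.Wf
  | .assign r e => e.Wf && 0 < r && r < 16
  | .store k e f g => e.Wf && f.Wf && g.Wf && k < 10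
  | .ite e f c d => e.Wf && f.Wf && c.Wf && d.Wf
  | .loop i b c => c.Wf && 0 < i && i < 16 && b < 16 && c.keepsVar i && c.keepsVar b && i != b

/-- A bound for the running time if every loop makes at most `m` iterations. -/
def Cmd.cost (m : ℕ) : Cmd → ℕ
  | .skip => 0
  | .seq c d => c.cost m + d.cost m
  | .assign _ e => (e.code 16).length + 1
  | .store k e f g => (e.code 16 ++ f.code 17 ++ addrCode 16 k ++ g.code 17).length + 1
  | .ite e f c d => (e.code 16 ++ f.code 17).length + 2 + max (c.cost m) (d.cost m)
  | .loop _ _ c => m * (c.cost m + 4) + 3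

/-- The nesting depth of the loops. -/
def Cmd.depth : Cmd → ℕ
  | .skip => 0
  | .seq c d => max c.depth d.depth
  | .assign _ _ => 0
  | .store _ _ _ _ => 0
  | .ite _ _ c d => max c.depth d.depth
  | .loop _ _ c => c.depth + 1

/-- The cost is built from constants by sums, maxima and one factor m per loop, so it behaves like a
polynomial of degree at most the depth with non-negative coefficients, whose value at 1 is the sum
of the coefficients. -/
theorem Cmd.cost_le (c : Cmd) {m : ℕ} (hm : 1 ≤ m) {k : ℕ} (hk : c.depth ≤ k) :
    c.cost m ≤ c.cost 1 * m ^ k := by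
  have hone : ∀ (x k : ℕ), x ≤ x * m ^ k := fun x k =>
    Nat.le_mul_of_pos_right _ (Nat.pow_pos hm)
  induction c generalizing k with
  | skip => simp [cost]
  | seq c d ihc ihd =>
    simp only [depth, max_le_iff] at hk
    simp only [cost, add_mul]
    exact add_le_add (ihc hk.1) (ihd hk.2)
  | assign => exact hone _ _
  | store => exact hone _ _
  | ite e f c d ihc ihd =>
    simp only [depth, max_le_iff] at hk
    simp only [cost, add_mul]
    refine add_le_add (by simpa [add_mul] using hone ((e.code 16 ++ f.code 17).length + 2) k)
      (max_le ((ihc hk.1).trans ?_) ((ihd hk.2).trans ?_))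
    · exact Nat.mul_le_mul_right _ (le_max_left _ _)
    · exact Nat.mul_le_mul_right _ (le_max_right _ _)
  | loop i b c ih =>
    simp only [depth] at hk
    obtain ⟨k, rfl⟩ : ∃ l, k = l + 1 := ⟨k - 1, by omega⟩
    have h1 := ih (k := k) (by omega)
    have h2 := hone 4 k
    have h3 := hone 3 (k + 1)
    simp only [cost]
    calc m * (c.cost m + 4) + 3 ≤ m * (c.cost 1 * m ^ k + 4 * m ^ k) + 3 * m ^ (k + 1) := by gcongr
      _ = (1 * (c.cost 1 + 4) + 3) * m ^ (k + 1) := by ring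

/-! ### Executions of bounded length -/

/-- `P` leads from `c` to `c'` in at most `T` steps, with all words bounded by `B`. -/
def Reaches (P : Program) (B T : ℕ) (c c' : Config) : Prop :=
  ∃ t ≤ T, run P t c = c' ∧ ∀ s ≤ t, WordsLE B (run P s c)

theorem run_add (P : Program) (s t : ℕ) (c : Config) : run P (s + t) c = run P t (run P s c) := by
  rw [run, run, run, add_comm, Function.iterate_add_apply]

theorem Reaches.trans {P : Program} {B T T' : ℕ} {c c' c'' : Config} (h : Reaches P B T c c')
    (h' : Reaches P B T' c' c'') : Reaches P B (T + T') c c'' := by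
  obtain ⟨t, ht, hr, hw⟩ := h
  obtain ⟨t', ht', hr', hw'⟩ := h'
  refine ⟨t + t', by omega, by rw [run_add, hr, hr'], fun s hs => ?_⟩
  rcases le_total s t with h | h
  · exact hw s h
  · obtain ⟨u, rfl⟩ := Nat.exists_eq_add_of_le h
    rw [run_add, hr]
    exact hw' u (by omega)

theorem Reaches.mono {P : Program} {B T T' : ℕ} {c c' : Config} (h : Reaches P B T c c')
    (hT : T ≤ T') : Reaches P B T' c c' := by
  obtain ⟨t, ht, hr⟩ := h
  exact ⟨t, ht.trans hT, hr⟩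

theorem Reaches.refl {P : Program} {B T : ℕ} {c : Config} (h : WordsLE B c) :
    Reaches P B T c c :=
  ⟨0, by simp, rfl, fun s hs => by obtain rfl : s = 0 := by omega
                                   exact h⟩

/-- `L` stands in `P` at instruction number `o`. -/
def CodeAt (P : Program) (o : ℕ) (L : List Instr) : Prop :=
  ∃ A D, P = A ++ L ++ D ∧ A.length = o

theorem CodeAt.left {P : Program} {o : ℕ} {L L' : List Instr} (h : CodeAt P o (L ++ L')) :
    CodeAt P o L := by
  obtain ⟨A, D, rfl, hA⟩ := h
  exact ⟨A, L' ++ D, by simp, hA⟩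

theorem CodeAt.right {P : Program} {o : ℕ} {L L' : List Instr} (h : CodeAt P o (L ++ L')) :
    CodeAt P (o + L.length) L' := by
  obtain ⟨A, D, rfl, hA⟩ := h
  exact ⟨A ++ L, D, by simp, by simp [hA]⟩

theorem CodeAt.right' {P : Program} {o o' : ℕ} {L L' : List Instr} (h : CodeAt P o (L ++ L'))
    (ho : o + L.length = o') : CodeAt P o' L' := ho ▸ h.right

theorem CodeAt.tail {P : Program} {o : ℕ} {i : Instr} {L : List Instr} (h : CodeAt P o (i :: L)) :
    CodeAt P (o + 1) L :=
  CodeAt.right (L := [i]) h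

theorem CodeAt.reaches {P : Program} {o B : ℕ} {i : Instr} {L : List Instr} {c : Config}
    (h : CodeAt P o (i :: L)) (hpc : c.pc = o) (hc : WordsLE B c) (hc' : WordsLE B (i.exec c)) :
    Reaches P B 1 c (i.exec c) := by
  obtain ⟨A, D, rfl, rfl⟩ := h
  have hs : run (A ++ i :: L ++ D) 1 c = i.exec c := by
    simp only [run, Function.iterate_one, step]
    rw [hpc]
    simp
  refine ⟨1, le_rfl, hs, fun s hs' => ?_⟩
  rcases Nat.le_one_iff_eq_zero_or_eq_one.1 hs' with rfl | rfl
  · exact hc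
  · rw [hs]
    exact hc'

theorem WordsLE.update_reg {B : ℕ} {c c' : Config} {d x : ℕ} (h : WordsLE B c)
    (hr : c'.reg = Function.update c.reg d x) (hm : c'.mem = c.mem) (hx : x ≤ B) :
    WordsLE B c' := by
  refine ⟨fun a => ?_, fun a => hm ▸ h.2 a⟩
  rw [hr, Function.update_apply]
  split_ifs
  · exact hx
  · exact h.1 a

/-- One instruction that writes a register. -/
theorem CodeAt.reaches_reg {P : Program} {o B : ℕ} {i : Instr} {L : List Instr} {c : Config}
    (h : CodeAt P o (i :: L)) (hpc : c.pc = o) (hc : WordsLE B c) (d x : ℕ)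
    (hi : i.exec c = ⟨c.pc + 1, Function.update c.reg d x, c.mem⟩) (hx : x ≤ B) :
    ∃ c', Reaches P B 1 c c' ∧ c'.pc = o + 1 ∧ WordsLE B c' ∧
      c'.reg = Function.update c.reg d x ∧ c'.mem = c.mem := by
  have hw : WordsLE B (i.exec c) := hc.update_reg (by rw [hi]) (by rw [hi]) hx
  refine ⟨i.exec c, h.reaches hpc hc hw, ?_, hw, ?_, ?_⟩
  all_goals simp [hi, hpc]

/-! ### Correctness of compiled code -/

/-- The machine represents the state `s`. -/
structure Rel (n B : ℕ) (s : St) (c : Config) : Prop where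
  reg : ∀ r < 16, c.reg r = s.v r
  zero : s.v 0 = n
  mem : ∀ k i j, InRange n k i j → c.mem (addr n k i j) = s.a k i j
  words : WordsLE B c

/-- With fewer than ten arrays all intermediate values stay within about 11 (n + 1)²; the bound 100
(n + 1)³ is generous. -/
theorem addr_bounds {n k i j B : ℕ} (hk : k < 10) (h : InRange n k i j)
    (hB : 100 * (n + 1) ^ 3 ≤ B) :
    (k = 0 → i * n ≤ B ∧ i * n + j ≤ B) ∧ 1 + n ≤ B ∧ k * (n + 1) ≤ B ∧
      k * (n + 1) + i ≤ B ∧ (k ≠ 0 → (k * (n + 1) + i) * (n + 1) ≤ B ∧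
      (k * (n + 1) + i) * (n + 1) + j ≤ B) := by
  have hij : i < n + 1 ∧ j < n + 1 := by
    rw [InRange] at h
    split_ifs at h <;> omega
  have h1 : n + 1 ≤ (n + 1) ^ 3 := Nat.le_self_pow (by norm_num) _
  have h2 : (n + 1) * (n + 1) ≤ (n + 1) ^ 3 := by
    rw [← sq]
    exact Nat.pow_le_pow_right (by omega) (by norm_num)
  have h3 : i * n ≤ (n + 1) * (n + 1) := Nat.mul_le_mul (by omega) (by omega)
  have h4 : k * (n + 1) ≤ 9 * (n + 1) := Nat.mul_le_mul_right _ (by omega)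
  have h5 : (k * (n + 1) + i) * (n + 1) ≤ (10 * (n + 1)) * (n + 1) :=
    Nat.mul_le_mul_right _ (by omega)
  rw [mul_assoc] at h5
  refine ⟨fun _ => ⟨?_, ?_⟩, ?_, ?_, ?_, fun _ => ⟨?_, ?_⟩⟩
  all_goals omega

theorem addrCode_reaches {P : Program} {n B o d k i j : ℕ} {c : Config} (hk : k < 10)
    (hP : CodeAt P o (addrCode d k)) (hpc : c.pc = o) (hc : WordsLE B c)
    (h0 : c.reg 0 = n) (hi : c.reg d = i) (hj : c.reg (d + 1) = j) (h : InRange n k i j)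
    (hB : 100 * (n + 1) ^ 3 ≤ B) :
    ∃ c', Reaches P B (addrCode d k).length c c' ∧ c'.pc = o + (addrCode d k).length ∧
      WordsLE B c' ∧ c'.reg d = addr n k i j ∧ (∀ r < d, c'.reg r = c.reg r) ∧
      c'.mem = c.mem := by
  obtain ⟨b1, b2, b3, b4, b5⟩ := addr_bounds hk h hB
  have hpos : 1 ≤ (n + 1) ^ 3 := Nat.one_le_pow _ _ (by omega)
  unfold addrCode at hP ⊢
  split_ifs at hP ⊢ with hk0
  · obtain ⟨c1, r1, p1, w1, g1, m1⟩ := hP.reaches_reg hpc hc d (i * n)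
      (by simp [Instr.exec, hi, h0]) (b1 hk0).1
    obtain ⟨c2, r2, p2, w2, g2, m2⟩ := hP.tail.reaches_reg p1 w1 d (i * n + j)
      (by simp [Instr.exec, g1, hj]) (b1 hk0).2
    refine ⟨c2, r1.trans r2, p2, w2, by simp [g2, addr, hk0], fun r hr => ?_, m2.trans m1⟩
    simp [g2, g1, hr.ne]
  · obtain ⟨c1, r1, p1, w1, g1, m1⟩ := hP.reaches_reg hpc hc (d + 2) 1 rfl (by omega)
    obtain ⟨c2, r2, p2, w2, g2, m2⟩ := hP.tail.reaches_reg p1 w1 (d + 2) (n + 1)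
      (by simp [Instr.exec, g1, h0, add_comm]) (by omega)
    obtain ⟨c3, r3, p3, w3, g3, m3⟩ := hP.tail.tail.reaches_reg p2 w2 (d + 3) k rfl (by omega)
    obtain ⟨c4, r4, p4, w4, g4, m4⟩ := hP.tail.tail.tail.reaches_reg p3 w3 (d + 3) (k * (n + 1))
      (by simp [Instr.exec, g3, g2]) b3
    obtain ⟨c5, r5, p5, w5, g5, m5⟩ := hP.tail.tail.tail.tail.reaches_reg p4 w4 d
      (k * (n + 1) + i)
      (by simp [Instr.exec, g4, g3, g2, g1, hi, add_comm]) b4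
    obtain ⟨c6, r6, p6, w6, g6, m6⟩ := hP.tail.tail.tail.tail.tail.reaches_reg p5 w5 d
      ((k * (n + 1) + i) * (n + 1))
      (by simp [Instr.exec, g5, g4, g3, g2]) (b5 hk0).1
    obtain ⟨c7, r7, p7, w7, g7, m7⟩ := hP.tail.tail.tail.tail.tail.tail.reaches_reg p6 w6 d
      ((k * (n + 1) + i) * (n + 1) + j)
      (by simp [Instr.exec, g6, g5, g4, g3, g2, g1, hj]) (b5 hk0).2
    refine ⟨c7, (((((r1.trans r2).trans r3).trans r4).trans r5).trans r6).trans r7, p7, w7,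
      by simp [g7, addr, hk0], fun r hr => ?_, by rw [m7, m6, m5, m4, m3, m2, m1]⟩
    have e1 : r ≠ d := by omega
    have e2 : r ≠ d + 2 := by omega
    have e3 : r ≠ d + 3 := by omega
    simp [g7, g6, g5, g4, g3, g2, g1, e1, e2, e3]

theorem Rel.of_eq {n B : ℕ} {s : St} {c c' : Config} (h : Rel n B s c) (hw : WordsLE B c')
    (hr : ∀ r < 16, c'.reg r = c.reg r) (hm : c'.mem = c.mem) : Rel n B s c' :=
  ⟨fun r hr' => (hr r hr').trans (h.reg r hr'), h.zero, fun k i j hi => hm ▸ h.mem k i j hi, hw⟩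

/-- Evaluation follows a stack discipline: code targeting register d leaves the registers below d
alone, so a first operand in d survives the evaluation of the second in d + 1. -/
theorem Expr.code_reaches {P : Program} {n B : ℕ} {s : St} (hB : 100 * (n + 1) ^ 3 ≤ B) (e : Expr)
    (he : e.Wf = true) (hok : e.Ok n B s) {o d : ℕ} {c : Config} (hd : 16 ≤ d)
    (hP : CodeAt P o (e.code d)) (hpc : c.pc = o) (hc : Rel n B s c) :
    ∃ c', Reaches P B (e.code d).length c c' ∧ c'.pc = o + (e.code d).length ∧
      Rel n B s c' ∧ c'.reg d = e.eval s ∧ (∀ r < d, c'.reg r = c.reg r) ∧ c'.mem = c.mem := by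
  induction e generalizing o d c with
  | lit x =>
    obtain ⟨c1, r1, p1, w1, g1, m1⟩ := hP.reaches_reg hpc hc.words d x rfl hok
    have hlt : ∀ r < d, c1.reg r = c.reg r := fun r hr => by
      simp [g1, hr.ne]
    exact ⟨c1, r1, p1, hc.of_eq w1 (fun r hr => hlt r (by omega)) m1, by simp [g1], hlt, m1⟩
  | var x =>
    obtain ⟨c1, r1, p1, w1, g1, m1⟩ := hP.reaches_reg hpc hc.words d (c.reg x) rfl
      (hc.words.1 _)
    have hlt : ∀ r < d, c1.reg r = c.reg r := fun r hr => by
      simp [g1, hr.ne]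
    refine ⟨c1, r1, p1, hc.of_eq w1 (fun r hr => hlt r (by omega)) m1, ?_, hlt, m1⟩
    simp only [Wf, decide_eq_true_eq] at he
    simp [g1, hc.reg x he]
  | add e f ihe ihf =>
    simp only [Wf, Bool.and_eq_true] at he
    simp only [Ok] at hok
    obtain ⟨c1, r1, p1, l1, g1, k1, m1⟩ := ihe he.1 hok.1 hd hP.left.left hpc hc
    obtain ⟨c2, r2, p2, l2, g2, k2, m2⟩ := ihf he.2 hok.2.1 (by omega) hP.left.right p1 l1
    obtain ⟨c3, r3, p3, w3, g3, m3⟩ := hP.right.reaches_reg (by simpa [add_assoc] using p2)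
      l2.words d (e.eval s + f.eval s)
      (by simp [Instr.exec, g2, k2 d (by omega), g1]) hok.2.2
    have hlt : ∀ r < d, c3.reg r = c.reg r := fun r hr => by
      simp [g3, hr.ne, k2 r (by omega), k1 r hr]
    have hm := (m3.trans m2).trans m1
    refine ⟨c3, ((r1.trans r2).trans r3).mono (by simp [Expr.code, add_assoc]), ?_,
      hc.of_eq w3 (fun r hr => hlt r (by omega)) hm, by simp [g3], hlt, hm⟩
    rw [p3]
    simp [Expr.code, add_assoc]
  | sub e f ihe ihf =>
    simp only [Wf, Bool.and_eq_true] at he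
    simp only [Ok] at hok
    obtain ⟨c1, r1, p1, l1, g1, k1, m1⟩ := ihe he.1 hok.1 hd hP.left.left hpc hc
    obtain ⟨c2, r2, p2, l2, g2, k2, m2⟩ := ihf he.2 hok.2 (by omega) hP.left.right p1 l1
    obtain ⟨c3, r3, p3, w3, g3, m3⟩ := hP.right.reaches_reg (by simpa [add_assoc] using p2)
      l2.words d (e.eval s - f.eval s)
      (by simp [Instr.exec, g2, k2 d (by omega), g1])
      ((Nat.sub_le _ _).trans (g1 ▸ l1.words.1 d))
    have hlt : ∀ r < d, c3.reg r = c.reg r := fun r hr => by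
      simp [g3, hr.ne, k2 r (by omega), k1 r hr]
    have hm := (m3.trans m2).trans m1
    refine ⟨c3, ((r1.trans r2).trans r3).mono (by simp [Expr.code, add_assoc]), ?_,
      hc.of_eq w3 (fun r hr => hlt r (by omega)) hm, by simp [g3], hlt, hm⟩
    rw [p3]
    simp [Expr.code, add_assoc]
  | ld k e f ihe ihf =>
    simp only [Wf, Bool.and_eq_true, decide_eq_true_eq] at he
    simp only [Ok] at hok
    obtain ⟨c1, r1, p1, l1, g1, k1, m1⟩ := ihe he.1.1 hok.1 hd hP.left.left.left hpc hc
    obtain ⟨c2, r2, p2, l2, g2, k2, m2⟩ := ihf he.1.2 hok.2.1 (by omega) hP.left.left.right p1 l1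
    obtain ⟨c3, r3, p3, w3, g3, k3, m3⟩ := addrCode_reaches he.2 hP.left.right
      (by simpa [add_assoc] using p2) l2.words ((l2.reg 0 (by omega)).trans l2.zero)
      ((k2 d (by omega)).trans g1) g2 hok.2.2 hB
    have hv : c3.mem (c3.reg d) = s.a k (e.eval s) (f.eval s) := by
      rw [g3, m3]
      exact l2.mem _ _ _ hok.2.2
    obtain ⟨c4, r4, p4, w4, g4, m4⟩ := hP.right.reaches_reg (by simpa [add_assoc] using p3)
      w3 d (s.a k (e.eval s) (f.eval s)) (by simp [Instr.exec, hv]) (hv ▸ w3.2 _)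
    have hlt : ∀ r < d, c4.reg r = c.reg r := fun r hr => by
      simp [g4, hr.ne, k3 r hr, k2 r (by omega), k1 r hr]
    have hm := ((m4.trans m3).trans m2).trans m1
    refine ⟨c4, (((r1.trans r2).trans r3).trans r4).mono (by simp [Expr.code, add_assoc]), ?_,
      hc.of_eq w4 (fun r hr => hlt r (by omega)) hm, by simp [g4], hlt, hm⟩
    rw [p4]
    simp [Expr.code, add_assoc]

theorem Cmd.code_length (c : Cmd) (o : ℕ) : (c.code o).length = c.len := by
  induction c generalizing o with
  | skip => rfl
  | seq c d ihc ihd => simp [code, len, ihc, ihd]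
  | assign => simp [code, len]
  | store =>
    simp [code, len]
    omega
  | ite e f c d ihc ihd =>
    simp [code, len, ihc, ihd]
    omega
  | loop i b c ih =>
    simp [code, len, ih]
    omega

theorem Rel.setVar {n B : ℕ} {s : St} {c c' : Config} {r x : ℕ} (h : Rel n B s c) (hr0 : 0 < r)
    (hr : c'.reg = Function.update c.reg r x) (hm : c'.mem = c.mem) (hw : WordsLE B c') :
    Rel n B (s.setVar r x) c' := by
  refine ⟨fun q hq => ?_, ?_, fun k i j hi => hm ▸ h.mem k i j hi, hw⟩
  · rw [hr, St.setVar_v, Function.update_apply, h.reg q hq]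
  · rw [St.setVar_v, if_neg hr0.ne, h.zero]

/-- Simulation theorem for the compiler, by induction on the command. Time, word size and the
represented state are carried along together. -/
theorem Cmd.code_reaches {P : Program} {n B : ℕ} (hB : 100 * (n + 1) ^ 3 ≤ B) (p : Cmd)
    (hwf : p.Wf = true) {s : St} (hok : p.Ok n B s) {o : ℕ} {c : Config}
    (hP : CodeAt P o (p.code o)) (hpc : c.pc = o) (hc : Rel n B s c) :
    ∃ c', Reaches P B (p.cost (n + 1)) c c' ∧ c'.pc = o + p.len ∧ Rel n B (p.eval s) c' := by
  have hB1 : 1 ≤ B := by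
    have : 1 ≤ (n + 1) ^ 3 := Nat.one_le_pow _ _ (by omega)
    omega
  have hBn : n + 1 ≤ B := by
    have : n + 1 ≤ (n + 1) ^ 3 := Nat.le_self_pow (by norm_num) _
    omega
  induction p generalizing s o c with
  | skip => exact ⟨c, Reaches.refl hc.words, hpc, hc⟩
  | seq p q ihp ihq =>
    simp only [Wf, Bool.and_eq_true] at hwf
    simp only [Ok] at hok
    obtain ⟨c1, r1, p1, l1⟩ := ihp hwf.1 hok.1 hP.left hpc hc
    obtain ⟨c2, r2, p2, l2⟩ := ihq hwf.2 hok.2 (hP.right' (by rw [code_length])) p1 l1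
    exact ⟨c2, r1.trans r2, by rw [p2, len, add_assoc], l2⟩
  | assign r e =>
    simp only [Wf, Bool.and_eq_true, decide_eq_true_eq] at hwf
    obtain ⟨c1, r1, p1, l1, g1, -, -⟩ := e.code_reaches hB hwf.1.1 hok le_rfl hP.left hpc hc
    obtain ⟨c2, r2, p2, w2, g2, m2⟩ := hP.right.reaches_reg p1 l1.words r (e.eval s)
      (by simp [Instr.exec, g1]) (g1 ▸ l1.words.1 _)
    exact ⟨c2, r1.trans r2, by rw [p2, len]; rfl, l1.setVar hwf.1.2 g2 m2 w2⟩
  | store k e f g =>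
    simp only [Wf, Bool.and_eq_true, decide_eq_true_eq] at hwf
    obtain ⟨ok1, ok2, ok3, ok4⟩ := hok
    obtain ⟨c1, r1, p1, l1, g1, -, -⟩ := e.code_reaches hB hwf.1.1.1 ok1 le_rfl
      hP.left.left.left.left hpc hc
    obtain ⟨c2, r2, p2, l2, g2, k2, -⟩ := f.code_reaches hB hwf.1.1.2 ok2 (d := 17) (by omega)
      hP.left.left.left.right p1 l1
    obtain ⟨c3, r3, p3, w3, g3, k3, m3⟩ := addrCode_reaches hwf.2 hP.left.left.right
      (by simpa [add_assoc] using p2) l2.words ((l2.reg 0 (by omega)).trans l2.zero)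
      ((k2 16 (by omega)).trans g1) g2 ok4 hB
    have l3 : Rel n B s c3 := l2.of_eq w3 (fun r hr => k3 r hr) m3
    obtain ⟨c4, r4, p4, l4, g4, k4, -⟩ := g.code_reaches hB hwf.1.2 ok3 (d := 17) (by omega)
      hP.left.right (by simpa [add_assoc] using p3) l3
    have hw : WordsLE B ((Instr.store 16 17).exec c4) := by
      refine ⟨l4.words.1, fun a => ?_⟩
      simp only [Instr.exec, Function.update_apply]
      split_ifs
      · exact l4.words.1 _
      · exact l4.words.2 _
    have r5 := hP.right.reaches (by rw [p4]; simp [add_assoc]) l4.words hw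
    refine ⟨_, ((((r1.trans r2).trans r3).trans r4).trans r5).mono
      (by simp [Cmd.cost, add_assoc]), by simp [Instr.exec, p4, len, add_assoc],
      ⟨l4.reg, l4.zero, fun k' i' j' hi => ?_, hw⟩⟩
    simp only [Instr.exec, Cmd.eval, St.setArr_a, Function.update_apply, k4 16 (by omega), g3, g4]
    by_cases h : k' = k ∧ i' = e.eval s ∧ j' = f.eval s
    · obtain ⟨rfl, rfl, rfl⟩ := h
      simp
    -- Injectivity of addresses: the store does not affect any other entry.
    · rw [if_neg h, if_neg fun h' => h (addr_inj hi ok4 h')]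
      exact l4.mem _ _ _ hi
  | ite e f p q ihp ihq =>
    simp only [Wf, Bool.and_eq_true] at hwf
    obtain ⟨ok1, ok2, ok3⟩ := hok
    simp only [code] at hP
    obtain ⟨c1, r1, p1, l1, g1, -, -⟩ := e.code_reaches hB hwf.1.1.1 ok1 le_rfl
      hP.left.left.left.left.left hpc hc
    obtain ⟨c2, r2, p2, l2, g2, k2, -⟩ := f.code_reaches hB hwf.1.1.2 ok2 (d := 17) (by omega)
      hP.left.left.left.left.right p1 l1
    have ha : c2.reg 16 = e.eval s := (k2 16 (by omega)).trans g1
    have r3 := hP.left.left.left.right.reaches (by rw [p2]; simp [add_assoc]) l2.words l2.words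
    by_cases hlt : e.eval s < f.eval s
    · rw [if_pos hlt] at ok3
      obtain ⟨c4, r4, p4, l4⟩ := ihp hwf.1.2 ok3
        (c := (Instr.jumpLt 16 17 (o + (e.code 16 ++ f.code 17).length + 1 + q.len + 1)).exec c2)
        (hP.right' (o' := o + (e.code 16 ++ f.code 17).length + 1 + q.len + 1)
          (by simp [code_length]; omega))
        (by simp [Instr.exec, ha, g2, hlt]) (l2.of_eq l2.words (fun _ _ => rfl) rfl)
      refine ⟨c4, (((r1.trans r2).trans r3).trans r4).mono ?_, ?_, by
        simpa [eval, hlt] using l4⟩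
      · have := le_max_left (p.cost (n + 1)) (q.cost (n + 1))
        simp [cost]
        omega
      · rw [p4, len]
        omega
    · rw [if_neg hlt] at ok3
      obtain ⟨c4, r4, p4, l4⟩ := ihq hwf.2 ok3 (hP.left.left.right' (by simp; omega))
        (by simp [Instr.exec, ha, g2, hlt, p2]; omega)
        (l2.of_eq (c' := (Instr.jumpLt 16 17 _).exec c2) l2.words (fun _ _ => rfl) rfl)
      have r5 := hP.left.right.reaches (by rw [p4]; simp [code_length]; omega) l4.words l4.words
      refine ⟨_, ((((r1.trans r2).trans r3).trans r4).trans r5).mono ?_, ?_, by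
        rw [eval, if_neg hlt]
        exact l4.of_eq l4.words (fun _ _ => rfl) rfl⟩
      · have := le_max_right (p.cost (n + 1)) (q.cost (n + 1))
        simp [cost]
        omega
      · simp [Instr.exec, len]
        omega
  | loop i b p ih =>
    simp only [Wf, Bool.and_eq_true, decide_eq_true_eq, bne_iff_ne] at hwf
    obtain ⟨⟨⟨⟨⟨⟨hp, hi0⟩, hi⟩, hb⟩, hki⟩, hkb⟩, hib⟩ := hwf
    obtain ⟨hbn, hok⟩ := hok
    simp only [code] at hP
    have cd0 := hP.left.left
    have cdb : CodeAt P (o + 3) (p.code (o + 3)) := hP.left.right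
    have cde : CodeAt P (o + 3 + p.len) _ := hP.right' (by simp [code_length]; omega)
    set F := fun j t => p.eval (St.setVar t i j) with hF
    have hvb : ∀ m, (iter F m s).v b = s.v b := by
      intro m
      induction m with
      | zero => rfl
      | succ m ihm => rw [iter, hF, p.eval_v_of_keepsVar hkb, St.setVar_v, if_neg hib.symm, ihm]
    obtain ⟨c1, r1, p1, w1, g1, m1⟩ := cd0.reaches_reg hpc hc.words i 0 rfl (by omega)
    -- The situation at the loop test after m iterations. Each iteration costs four instructions
    -- besides the body: the test, loading 1, the increment and the jump back.
    have key : ∀ m ≤ s.v b, ∃ c', Reaches P B (1 + m * (p.cost (n + 1) + 4)) c c' ∧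
        c'.pc = o + 1 ∧ Rel n B ((iter F m s).setVar i m) c' := by
      intro m hm
      induction m with
      | zero => exact ⟨c1, r1.mono (by omega), p1, hc.setVar hi0 g1 m1 w1⟩
      | succ m ihm =>
        obtain ⟨d0, q0, e0, l0⟩ := ihm (by omega)
        have hri : d0.reg i = m := by rw [l0.reg i hi, St.setVar_v, if_pos rfl]
        have hrb : d0.reg b = s.v b := by
          rw [l0.reg b hb, St.setVar_v, if_neg hib.symm, hvb]
        have q1 := cd0.tail.reaches e0 l0.words l0.words
        obtain ⟨d2, q2, e2, l2⟩ := ih hp (hok m (by omega)) cdb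
          (by simp [Instr.exec, hri, hrb]; omega)
          (l0.of_eq (c' := (Instr.jumpLt i b (o + 3)).exec d0) l0.words (fun _ _ => rfl) rfl)
        obtain ⟨d3, q3, e3, w3, g3, m3⟩ := cde.reaches_reg e2 l2.words 16 1 rfl hB1
        have l3 : Rel n B _ d3 := l2.of_eq w3
          (fun r hr => by rw [g3, Function.update_apply, if_neg hr.ne]) m3
        have hri' : d3.reg i = m := by
          rw [l3.reg i hi, p.eval_v_of_keepsVar hki, St.setVar_v, if_pos rfl]
        obtain ⟨d4, q4, e4, w4, g4, m4⟩ := cde.tail.reaches_reg e3 w3 i (m + 1)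
          (by simp [Instr.exec, hri', g3]) (by omega)
        have l4 := l3.setVar hi0 g4 m4 w4
        have q5 := cde.tail.tail.reaches e4 w4 w4
        refine ⟨_, (((((q0.trans q1).trans q2).trans q3).trans q4).trans q5).mono ?_, rfl,
          l4.of_eq w4 (fun _ _ => rfl) rfl⟩
        ring_nf
        omega
    obtain ⟨c2, r2, p2, l2⟩ := key _ le_rfl
    have hri : c2.reg i = s.v b := by rw [l2.reg i hi, St.setVar_v, if_pos rfl]
    have hrb : c2.reg b = s.v b := by rw [l2.reg b hb, St.setVar_v, if_neg hib.symm, hvb]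
    have r3 := cd0.tail.reaches p2 l2.words l2.words
    have r4 := cd0.tail.tail.reaches (c := (Instr.jumpLt i b (o + 3)).exec c2)
      (by simp [Instr.exec, hri, hrb, p2]) l2.words l2.words
    refine ⟨_, ((r2.trans r3).trans r4).mono ?_, ?_, l2.of_eq l2.words (fun _ _ => rfl) rfl⟩
    · have := Nat.mul_le_mul_right (p.cost (n + 1) + 4) hbn
      simp only [cost]
      omega
    · simp [Instr.exec, len]
      omega

end WordRAM

namespace WordRAM

/-! ### Program logic -/

/-- `c` runs within the bounds from `s` and ends in a state satisfying `Q`. -/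
def Cmd.Tr (n B : ℕ) (c : Cmd) (s : St) (Q : St → Prop) : Prop :=
  c.Ok n B s ∧ Q (c.eval s)

/-- `t` agrees with `s` except where `c` writes. -/
def Cmd.Frame (c : Cmd) (s t : St) : Prop :=
  (∀ r, c.keepsVar r = true → t.v r = s.v r) ∧ ∀ k, c.keepsArr k = true → t.a k = s.a k

section Logic

variable {n B : ℕ} {c d : Cmd} {s : St} {Q Q' : St → Prop}

/-- Whatever is not written is preserved, by a syntactic check that `rfl` decides. Invariants
therefore mention only what a command changes. -/
theorem Cmd.Tr.frame (h : c.Tr n B s Q) (hQ : ∀ t, c.Frame s t → Q t → Q' t) : c.Tr n B s Q' :=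
  ⟨h.1, hQ _ ⟨fun _ hr => c.eval_v_of_keepsVar hr s, fun _ hk => c.eval_a_of_keepsArr hk s⟩ h.2⟩

theorem Cmd.Tr.skip (h : Q s) : Cmd.skip.Tr n B s Q := ⟨trivial, h⟩

theorem Cmd.Tr.seq (h : c.Tr n B s fun t => d.Tr n B t Q) : (Cmd.seq c d).Tr n B s Q :=
  ⟨⟨h.1, h.2.1⟩, h.2.2⟩

theorem Cmd.Tr.assign {r : ℕ} {e : Expr} (he : e.Ok n B s) (h : Q (s.setVar r (e.eval s))) :
    (Cmd.assign r e).Tr n B s Q := ⟨he, h⟩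

theorem Cmd.Tr.store {k : ℕ} {e f g : Expr} (he : e.Ok n B s) (hf : f.Ok n B s) (hg : g.Ok n B s)
    (hr : InRange n k (e.eval s) (f.eval s))
    (h : Q (s.setArr k (e.eval s) (f.eval s) (g.eval s))) :
    (Cmd.store k e f g).Tr n B s Q := ⟨⟨he, hf, hg, hr⟩, h⟩

theorem Cmd.Tr.ite {e f : Expr} (he : e.Ok n B s) (hf : f.Ok n B s)
    (hc : e.eval s < f.eval s → c.Tr n B s Q) (hd : ¬ e.eval s < f.eval s → d.Tr n B s Q) :
    (Cmd.ite e f c d).Tr n B s Q := by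
  by_cases h : e.eval s < f.eval s
  · exact ⟨⟨he, hf, by rw [if_pos h]; exact (hc h).1⟩, by rw [Cmd.eval, if_pos h]; exact (hc h).2⟩
  · exact ⟨⟨he, hf, by rw [if_neg h]; exact (hd h).1⟩, by rw [Cmd.eval, if_neg h]; exact (hd h).2⟩

/-- The loop rule; what the body does not write is kept automatically. -/
theorem Cmd.Tr.loop {i b : ℕ} (I : ℕ → St → Prop) (hb : s.v b ≤ n + 1) (h0 : I 0 s)
    (hstep : ∀ m < s.v b, ∀ t, (Cmd.loop i b c).Frame s t → I m t →
      c.Tr n B (t.setVar i m) (I (m + 1)))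
    (hend : ∀ t, (Cmd.loop i b c).Frame s t → I (s.v b) t → Q (t.setVar i (s.v b))) :
    (Cmd.loop i b c).Tr n B s Q := by
  have key : ∀ m ≤ s.v b, (Cmd.loop i b c).Frame s
      (iter (fun j t => c.eval (t.setVar i j)) m s) ∧
      I m (iter (fun j t => c.eval (t.setVar i j)) m s) ∧
      ∀ l < m, c.Ok n B ((iter (fun j t => c.eval (t.setVar i j)) l s).setVar i l) := by
    intro m hm
    induction m with
    | zero => exact ⟨⟨fun _ _ => rfl, fun _ _ => rfl⟩, h0, by simp⟩
    | succ m ih =>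
      obtain ⟨hf, hI, hl⟩ := ih (by omega)
      have hs := hstep m (by omega) _ hf hI
      refine ⟨⟨fun r hr => ?_, fun k hk => ?_⟩, hs.2, fun l hl' => ?_⟩
      · have hr' := hr
        simp only [Cmd.keepsVar, Bool.and_eq_true, bne_iff_ne] at hr'
        rw [iter, c.eval_v_of_keepsVar hr'.2, St.setVar_v, if_neg hr'.1.symm, hf.1 r hr]
      · rw [iter, c.eval_a_of_keepsArr hk, St.setVar_a, hf.2 k hk]
      · rcases Nat.lt_succ_iff_lt_or_eq.1 hl' with h | rfl
        · exact hl l h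
        · exact hs.1
  obtain ⟨hf, hI, hl⟩ := key _ le_rfl
  exact ⟨⟨hb, hl⟩, hend _ hf hI⟩

end Logic

/-- One-armed conditional. -/
def Cmd.when (e f : Expr) (c : Cmd) : Cmd := .ite e f c .skip

theorem Cmd.Tr.when {n B : ℕ} {s : St} {Q : St → Prop} {c : Cmd} {e f : Expr}
    (he : e.Ok n B s) (hf : f.Ok n B s) (hc : e.eval s < f.eval s → c.Tr n B s Q)
    (hd : ¬ e.eval s < f.eval s → Q s) : (Cmd.when e f c).Tr n B s Q :=
  .ite he hf hc fun h => .skip (hd h)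

/-! ### The program

Variables: `0` the order `n`, `1` the number `h`, `2` the number `n + 1`, `3`, `4`, `5` loop
counters, `6` and `7` a pair of twins, `8` the round, `9` an accumulator.
Arrays: `0` adjacency, `1` numbers of distinguishing vertices, `2` tables, `3` sizes of the modules
(in row `0`), `4` the table of pairs. -/

open WordRAM.Expr WordRAM.Cmd

/-- Whether exactly one of `e`, `f` is adjacent to `g`. -/
def diffExpr (e f g : Expr) : Expr :=
  add (sub (ld 0 e g) (ld 0 f g)) (sub (ld 0 f g) (ld 0 e g))

/-- The expression may refer to the indices of the current entry through variables 4 and 5. -/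
def updateDiff (g : Expr) : Cmd :=
  loop 4 0 (loop 5 0 (store 1 (var 4) (var 5) g))

def initTable : Cmd :=
  loop 4 2 (when (lit 0) (var 4) (store 2 (var 3) (var 4) (lit 1)))

/-- The counts are accumulated one distinguishing vertex at a time, at quadratic cost each. -/
def initAll : Cmd :=
  loop 3 0 (seq (store 3 (lit 0) (var 3) (lit 1)) (seq initTable
    (updateDiff (add (ld 1 (var 4) (var 5)) (diffExpr (var 4) (var 5) (var 3))))))

/-- A positive size marks a representative. Adjacent twins are distinguished by each other, so the
admissible count is twice the adjacency entry. The search has no early exit; a later pair overwrites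
an earlier one, and the second member is always the larger. -/
def findTwins : Cmd :=
  loop 3 0 (loop 4 0 (when (var 3) (var 4) (when (lit 0) (ld 3 (lit 0) (var 3))
    (when (lit 0) (ld 3 (lit 0) (var 4))
      (when (ld 1 (var 3) (var 4))
          (add (add (ld 0 (var 3) (var 4)) (ld 0 (var 3) (var 4))) (lit 1))
        (seq (assign 6 (var 3)) (assign 7 (var 4))))))))

def fillPairs : Cmd :=
  loop 3 2 (loop 4 2 (seq (store 4 (var 3) (var 4) (add (ld 2 (var 6) (var 3)) (ld 2 (var 7) (var 4))))
    (when (lit 0) (var 3) (when (lit 0) (var 4)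
      (when (ld 4 (var 3) (var 4)) (add (ld 4 (sub (var 3) (lit 1)) (sub (var 4) (lit 1))) (lit 1))
        (store 4 (var 3) (var 4)
          (add (ld 4 (sub (var 3) (lit 1)) (sub (var 4) (lit 1))) (lit 1))))))))

/-- Variable 3 runs through the totals x + y in increasing order and variable 9 is never reset, so
it holds the maximum over all totals up to the current one. -/
def collectPairs : Cmd :=
  seq (assign 9 (lit 0)) (loop 3 2 (seq
    (loop 4 2 (when (var 4) (add (var 3) (lit 1))
      (when (var 4) (add (ld 3 (lit 0) (var 6)) (lit 1))
        (when (sub (var 3) (var 4)) (add (ld 3 (lit 0) (var 7)) (lit 1))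
          (when (var 9) (ld 4 (var 4) (sub (var 3) (var 4)))
            (assign 9 (ld 4 (var 4) (sub (var 3) (var 4)))))))))
    (store 2 (var 6) (var 3) (var 9))))

def maxTables : Cmd :=
  loop 3 2 (when (ld 2 (var 6) (var 3)) (ld 2 (var 7) (var 3))
    (store 2 (var 6) (var 3) (ld 2 (var 7) (var 3))))

def mergeTables : Cmd :=
  ite (lit 0) (ld 0 (var 6) (var 7)) (seq fillPairs collectPairs) maxTables

/-- Size zero retires the second twin as a representative. -/
def mergeSizes : Cmd :=
  seq (store 3 (lit 0) (var 6) (add (ld 3 (lit 0) (var 6)) (ld 3 (lit 0) (var 7))))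
    (store 3 (lit 0) (var 7) (lit 0))

/-- Every part takes quadratic time; the counts are repaired by subtracting the contribution of the
retired vertex alone. -/
def oneRound : Cmd :=
  seq findTwins (seq mergeTables (seq mergeSizes
    (updateDiff (sub (ld 1 (var 4) (var 5)) (diffExpr (var 4) (var 5) (var 7))))))

/-- Computes the Hadwiger number into variable `1` and the answer into variable `10`. -/
def hadwigerCmd : Cmd :=
  seq (assign 2 (add (var 0) (lit 1))) (seq initAll (seq
    -- Skipping round 0 leaves n − 1 merges. Since the larger twin is retired, vertex 0 survives and
    -- the result stands in row 0.
    (loop 8 0 (when (lit 0) (var 8) oneRound)) (seq (assign 9 (ld 2 (lit 0) (var 0)))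
      (seq (ite (var 1) (add (var 9) (lit 1)) (assign 10 (lit 1)) (assign 10 (lit 0)))
        (assign 1 (var 9))))))

theorem hadwigerCmd_wf : hadwigerCmd.Wf = true := by decide

/-- The source of the exponent 3. -/
theorem hadwigerCmd_depth : hadwigerCmd.depth = 3 := by decide

/-! ### Verification of the parts -/

variable {n B : ℕ} {s : St}

/-- Updating in place is sound because `g` is evaluated while entry (i, j) still has its old value;
no other entry of array 1 is guaranteed to. -/
theorem updateDiff_tr {g : Expr} (F : ℕ → ℕ → ℕ) (h0 : s.v 0 = n)
    (hg : ∀ t : St, (updateDiff g).Frame s t → ∀ i < n, ∀ j < n, t.v 4 = i → t.v 5 = j →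
      t.a 1 i j = s.a 1 i j → g.Ok n B t ∧ g.eval t = F i j) :
    (updateDiff g).Tr n B s fun t => ∀ i < n, ∀ j < n, t.a 1 i j = F i j := by
  refine .loop (fun m t => ∀ i < n, ∀ j < n, t.a 1 i j = if i < m then F i j else s.a 1 i j)
    (by omega) (by simp) ?_ ?_
  · intro m hm t ft ht
    refine .loop (fun l t => ∀ i < n, ∀ j < n, t.a 1 i j =
      if i < m ∨ i = m ∧ j < l then F i j else s.a 1 i j) ?_ ?_ ?_ ?_
    · rw [St.setVar_v, if_neg (by decide), ft.1 0 rfl]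
      omega
    · simpa using ht
    · intro l hl t' ft' ht'
      have el : l < n := by
        rw [St.setVar_v, if_neg (by decide), ft.1 0 rfl] at hl
        omega
      have e4 : (t'.setVar 5 l).v 4 = m := by
        rw [St.setVar_v, if_neg (by decide), ft'.1 4 rfl, St.setVar_v, if_pos rfl]
      have e5 : (t'.setVar 5 l).v 5 = l := by rw [St.setVar_v, if_pos rfl]
      obtain ⟨g1, g2⟩ := hg (t'.setVar 5 l) ⟨fun r hr => by
          have hr' := hr
          simp only [updateDiff, Cmd.keepsVar, Bool.and_eq_true, bne_iff_ne, Bool.and_true] at hr'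
          rw [St.setVar_v, if_neg hr'.2.symm, ft'.1 r (by simp [Cmd.keepsVar, hr'.2]), St.setVar_v,
            if_neg hr'.1.symm, ft.1 r hr], fun k hk => by
          rw [St.setVar_a, ft'.2 k hk, St.setVar_a, ft.2 k hk]⟩ m (by omega) l el e4 e5
        (by rw [St.setVar_a, ht' m (by omega) l el, if_neg (by omega)])
      refine .store trivial trivial g1 ?_ ?_
      · simp only [Expr.eval, e4, e5, InRange]
        rw [if_neg (by decide)]
        omega
      · intro i hi j hj
        simp only [Expr.eval, e4, e5, g2, St.setArr_a, St.setVar_a, ht' i hi j hj]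
        by_cases h : i = m ∧ j = l
        · obtain ⟨rfl, rfl⟩ := h
          simp
        · have : (i < m ∨ i = m ∧ j < l + 1) ↔ (i < m ∨ i = m ∧ j < l) := by omega
          rw [if_neg fun h' => h h'.2]
          simp only [this]
    · intro t' ft' ht' i hi j hj
      rw [St.setVar_v, if_neg (by decide), ft.1 0 rfl, h0] at ht'
      rw [St.setVar_a, ht' i hi j hj]
      have : (i < m ∨ i = m ∧ j < n) ↔ i < m + 1 := by omega
      simp [this]
  · intro t ft ht i hi j hj
    rw [St.setVar_a, ht i hi j hj, if_pos (by omega)]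

theorem initTable_tr (h0 : s.v 2 = n + 1) (h3 : s.v 3 < n) (hB : 1 ≤ B) (hz : s.a 2 (s.v 3) = 0) :
    initTable.Tr n B s fun t => (∀ d ≤ n, t.a 2 (s.v 3) d = if 0 < d then 1 else 0) ∧
      ∀ u ≠ s.v 3, t.a 2 u = s.a 2 u := by
  refine .loop (fun m t => (∀ d, t.a 2 (s.v 3) d = if 0 < d ∧ d < m then 1 else 0) ∧
      ∀ u ≠ s.v 3, t.a 2 u = s.a 2 u) (by omega) (by simp [hz]) ?_ ?_
  · rintro m hm t ft ⟨ht, ht'⟩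
    have e3 : (t.setVar 4 m).v 3 = s.v 3 := by rw [St.setVar_v, if_neg (by decide), ft.1 3 rfl]
    have e4 : (t.setVar 4 m).v 4 = m := by rw [St.setVar_v, if_pos rfl]
    refine .when (by simp) (by simp) ?_ ?_
    · intro hlt
      simp only [Expr.eval, e4] at hlt
      refine .store trivial trivial hB ?_ ⟨?_, ?_⟩
      · simp only [Expr.eval, e4, e3, InRange]
        rw [if_neg (by decide)]
        omega
      · intro d
        simp only [Expr.eval, e4, e3, St.setArr_a, St.setVar_a, ht d, true_and]
        split_ifs <;> omega
      · intro u hu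
        funext d
        simp only [Expr.eval, e4, e3, St.setArr_a, St.setVar_a, ht' u hu]
        simp [hu]
    · intro hlt
      simp only [Expr.eval, e4] at hlt
      refine ⟨fun d => ?_, ht'⟩
      rw [St.setVar_a, ht]
      split_ifs <;> omega
  · rintro t ft ⟨ht, ht'⟩
    refine ⟨fun d hd => ?_, ht'⟩
    rw [St.setVar_a, ht]
    split_ifs <;> omega

theorem findTwins_tr (h0 : s.v 0 = n) (hB : 3 ≤ B) (hA : ∀ i < n, ∀ j < n, s.a 0 i j ≤ 1) :
    findTwins.Tr n B s fun t =>
      (∃ i < n, ∃ j < n, i < j ∧ 0 < s.a 3 0 i ∧ 0 < s.a 3 0 j ∧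
        s.a 1 i j < s.a 0 i j + s.a 0 i j + 1) →
      t.v 6 < t.v 7 ∧ t.v 7 < n ∧ 0 < s.a 3 0 (t.v 6) ∧ 0 < s.a 3 0 (t.v 7) ∧
        s.a 1 (t.v 6) (t.v 7) < s.a 0 (t.v 6) (t.v 7) + s.a 0 (t.v 6) (t.v 7) + 1 := by
  set C : ℕ → ℕ → Prop := fun i j => i < j ∧ j < n ∧ 0 < s.a 3 0 i ∧ 0 < s.a 3 0 j ∧
    s.a 1 i j < s.a 0 i j + s.a 0 i j + 1 with hC
  -- The invariant is an implication: variables 6 and 7 are meaningless until a suitable pair has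
  -- been met.
  refine .loop (fun m t => (∃ i < m, ∃ j, C i j) → C (t.v 6) (t.v 7)) (by omega) (by simp) ?_ ?_
  · intro m hm t ft ht
    refine .loop (fun l t => ((∃ i < m, ∃ j, C i j) ∨ ∃ j < l, C m j) → C (t.v 6) (t.v 7))
      ?_ ?_ ?_ ?_
    · rw [St.setVar_v, if_neg (by decide), ft.1 0 rfl]
      omega
    · simpa [St.setVar_v] using ht
    · intro l hl t' ft' ht'
      have el : l < n := by
        rw [St.setVar_v, if_neg (by decide), ft.1 0 rfl] at hl
        omega
      have hmn : m < n := by omega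
      have e3 : (t'.setVar 4 l).v 3 = m := by
        rw [St.setVar_v, if_neg (by decide), ft'.1 3 rfl, St.setVar_v, if_pos rfl]
      have e4 : (t'.setVar 4 l).v 4 = l := by rw [St.setVar_v, if_pos rfl]
      have a0 : (t'.setVar 4 l).a 0 = s.a 0 := (ft'.2 0 rfl).trans (ft.2 0 rfl)
      have a1 : (t'.setVar 4 l).a 1 = s.a 1 := (ft'.2 1 rfl).trans (ft.2 1 rfl)
      have a3 : (t'.setVar 4 l).a 3 = s.a 3 := (ft'.2 3 rfl).trans (ft.2 3 rfl)
      have hAb := hA m hmn l el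
      have hno : ¬ C m l → (((∃ i < m, ∃ j, C i j) ∨ ∃ j < l + 1, C m j) →
          C ((t'.setVar 4 l).v 6) ((t'.setVar 4 l).v 7)) := by
        intro hn hor
        rw [St.setVar_v, St.setVar_v, if_neg (by decide), if_neg (by decide)]
        apply ht'
        rcases hor with h | ⟨j, hj, h⟩
        · exact Or.inl h
        · rcases Nat.lt_succ_iff_lt_or_eq.1 hj with hj | rfl
          · exact Or.inr ⟨j, hj, h⟩
          · exact absurd h hn
      refine .when (by simp) (by simp) (fun h1 => ?_) fun h1 => hno fun h => h1 ?_
      swap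
      · simpa [e3, e4] using h.1
      refine .when (by simp) (by simp [InRange, e3]; omega) (fun h2 => ?_)
        fun h2 => hno fun h => h2 ?_
      swap
      · simpa [e3, a3] using h.2.2.1
      refine .when (by simp) (by simp [InRange, e4]; omega) (fun h3 => ?_)
        fun h3 => hno fun h => h3 ?_
      swap
      · simpa [e4, a3] using h.2.2.2.1
      refine .when (by simp [InRange, e3, e4]; omega) ?_ (fun h4 => ?_)
        fun h4 => hno fun h => h4 ?_
      · simp [InRange, e3, e4, a0]
        omega
      swap
      · simpa [e3, e4, a0, a1] using h.2.2.2.2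
      simp only [Expr.eval, e3, e4, a0, a1, a3] at h1 h2 h3 h4
      refine .seq (.assign trivial (.assign trivial fun _ => ?_))
      simp only [St.setVar_v, Expr.eval, if_true] at e3 e4 ⊢
      simp only [e3]
      exact ⟨h1, el, h2, h3, h4⟩
    · intro t' ft' ht'
      rw [St.setVar_v, if_neg (by decide), ft.1 0 rfl, h0] at ht'
      rintro ⟨i, hi, j, hij⟩
      simp only [St.setVar_v]
      refine ht' ?_
      rcases Nat.lt_succ_iff_lt_or_eq.1 hi with hi | rfl
      · exact Or.inl ⟨i, hi, j, hij⟩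
      · exact Or.inr ⟨j, hij.2.1, hij⟩
  · rintro t ft ht ⟨i, hi, j, hj, h1, h2⟩
    simp only [St.setVar_v]
    exact ht ⟨i, by omega, j, h1, hj, h2⟩

end WordRAM

/-! ### Correctness of the merging of tables -/

namespace WordRAM

open WordRAM.Expr WordRAM.Cmd

variable {n B : ℕ} {s : St}

theorem fillPairs_tr {u v : ℕ} (h2 : s.v 2 = n + 1) (h6 : s.v 6 = u) (h7 : s.v 7 = v)
    (hu : u < n) (hv : v < n) (hB : 3 * (n + 1) ≤ B) (hgu : ∀ d ≤ n, s.a 2 u d ≤ d)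
    (hgv : ∀ d ≤ n, s.a 2 v d ≤ d) :
    fillPairs.Tr n B s fun t => ∀ x ≤ n, ∀ y ≤ n,
      t.a 4 x y = pairTable (s.a 2 u) (s.a 2 v) x y := by
  refine .loop (fun m t => ∀ x < m, ∀ y ≤ n, t.a 4 x y = pairTable (s.a 2 u) (s.a 2 v) x y)
    (by omega) (by simp) ?_ ?_
  · intro m hm t ft ht
    refine .loop (fun l t => ∀ x y, y ≤ n → (x < m ∨ x = m ∧ y < l) →
      t.a 4 x y = pairTable (s.a 2 u) (s.a 2 v) x y) ?_ ?_ ?_ ?_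
    · rw [St.setVar_v, if_neg (by decide), ft.1 2 rfl]
      omega
    · intro x y hy hx
      exact ht x (by omega) y hy
    · intro l hl t' ft' ht'
      have el : l ≤ n := by
        rw [St.setVar_v, if_neg (by decide), ft.1 2 rfl] at hl
        omega
      have hmn : m ≤ n := by omega
      have e3 : (t'.setVar 4 l).v 3 = m := by
        rw [St.setVar_v, if_neg (by decide), ft'.1 3 rfl, St.setVar_v, if_pos rfl]
      have e4 : (t'.setVar 4 l).v 4 = l := by rw [St.setVar_v, if_pos rfl]
      have e6 : (t'.setVar 4 l).v 6 = u := by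
        rw [St.setVar_v, if_neg (by decide), ft'.1 6 rfl, St.setVar_v, if_neg (by decide),
          ft.1 6 rfl, h6]
      have e7 : (t'.setVar 4 l).v 7 = v := by
        rw [St.setVar_v, if_neg (by decide), ft'.1 7 rfl, St.setVar_v, if_neg (by decide),
          ft.1 7 rfl, h7]
      have a2 : (t'.setVar 4 l).a 2 = s.a 2 := (ft'.2 2 rfl).trans (ft.2 2 rfl)
      have a4 : (t'.setVar 4 l).a 4 = t'.a 4 := rfl
      have b1 := hgu m hmn
      have b2 := hgv l el
      generalize t'.setVar 4 l = q at *
      refine .seq (.store trivial trivial ?_ ?_ ?_)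
      · simp [InRange, e3, e4, e6, e7, a2]
        omega
      · simp [InRange, e3, e4]
        omega
      -- All branches end alike: entry (m, l) has some final value `w`, the other entries are old,
      -- and only the value of `w` has to be checked.
      have key : ∀ w, w = pairTable (s.a 2 u) (s.a 2 v) m l → ∀ q' : St,
          (∀ x y, q'.a 4 x y = if x = m ∧ y = l then w else t'.a 4 x y) → ∀ x y, y ≤ n →
          (x < m ∨ x = m ∧ y < l + 1) → q'.a 4 x y = pairTable (s.a 2 u) (s.a 2 v) x y := by
        intro w hw q' hq' x y hy hxy
        rw [hq']
        split_ifs with h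
        · rw [hw, h.1, h.2]
        · exact ht' x y hy (by omega)
      set q' := q.setArr 4 ((var 3).eval q) ((var 4).eval q)
        ((add (ld 2 (var 6) (var 3)) (ld 2 (var 7) (var 4))).eval q) with hq'
      have q4 : ∀ x y, q'.a 4 x y = if x = m ∧ y = l then s.a 2 u m + s.a 2 v l
          else t'.a 4 x y := by
        intro x y
        simp only [hq', St.setArr_a, Expr.eval, e3, e4, e6, e7, a2, a4, true_and]
      have f3 : q'.v 3 = m := e3
      have f4 : q'.v 4 = l := e4
      clear_value q'
      refine .when (by simp) (by simp) (fun hm0 => ?_) fun hm0 => key _ ?_ _ q4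
      swap
      · simp only [Expr.eval, f3] at hm0
        obtain rfl : m = 0 := by omega
        simp [pairTable]
      refine .when (by simp) (by simp) (fun hl0 => ?_) fun hl0 => key _ ?_ _ q4
      swap
      · simp only [Expr.eval, f4] at hl0
        obtain rfl : l = 0 := by omega
        simp [pairTable]
      simp only [Expr.eval, f3, f4] at hm0 hl0
      obtain ⟨m, rfl⟩ : ∃ i, m = i + 1 := ⟨m - 1, by omega⟩
      obtain ⟨l, rfl⟩ : ∃ i, l = i + 1 := ⟨l - 1, by omega⟩
      -- The diagonal predecessor lies in the previous row, which is complete.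
      have p4 : q'.a 4 m l = pairTable (s.a 2 u) (s.a 2 v) m l := by
        rw [q4, if_neg (by omega), ht' m l (by omega) (by omega)]
      have p4' : q'.a 4 (m + 1) (l + 1) = s.a 2 u (m + 1) + s.a 2 v (l + 1) := by simp [q4]
      have b3 := pairTable_le hgu hgv (x := m) (y := l) (by omega) (by omega)
      have hok : (add (ld 4 (sub (var 3) (lit 1)) (sub (var 4) (lit 1))) (lit 1)).Ok n B q' := by
        simp [InRange, f3, f4, p4]
        omega
      refine .when (by simp [InRange, f3, f4]; omega) hok (fun h => ?_) fun h => key _ ?_ _ q4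
      · simp only [Expr.eval, f3, f4, p4, p4', Nat.add_sub_cancel] at h
        refine .store trivial trivial hok (by simp [InRange, f3, f4]; omega) ?_
        refine key (pairTable (s.a 2 u) (s.a 2 v) m l + 1) ?_ _ fun x y => ?_
        · rw [pairTable, max_eq_right h.le]
        · simp only [St.setArr_a, Expr.eval, f3, f4, p4, Nat.add_sub_cancel, true_and, q4]
          split_ifs <;> rfl
      · simp only [Expr.eval, f3, f4, p4, p4', Nat.add_sub_cancel] at h
        rw [pairTable, max_eq_left (by omega)]
    · intro t' ft' ht' x hx y hy
      rw [St.setVar_v, if_neg (by decide), ft.1 2 rfl, h2] at ht'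
      exact ht' x y hy (by omega)
  · intro t ft ht x hx y hy
    exact ht x (by omega) y hy

theorem collectPairs_tr {u v : ℕ} (h2 : s.v 2 = n + 1) (h6 : s.v 6 = u) (h7 : s.v 7 = v)
    (hu : u < n) (hv : v < n) (hB : n + 2 ≤ B) (hsu : s.a 3 0 u ≤ n) (hsv : s.a 3 0 v ≤ n) :
    collectPairs.Tr n B s fun t => (∀ d ≤ n, ∀ p, p ≤ t.a 2 u d ↔ p = 0 ∨ ∃ x y,
      x ≤ s.a 3 0 u ∧ y ≤ s.a 3 0 v ∧ x + y ≤ d ∧ p ≤ s.a 4 x y) ∧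
      ∀ w ≠ u, t.a 2 w = s.a 2 w := by
  refine .seq (.assign (by simp) ?_)
  refine .loop (fun m t => (∀ d < m, ∀ p, p ≤ t.a 2 u d ↔ p = 0 ∨ ∃ x y,
      x ≤ s.a 3 0 u ∧ y ≤ s.a 3 0 v ∧ x + y ≤ d ∧ p ≤ s.a 4 x y) ∧
      (∀ w ≠ u, t.a 2 w = s.a 2 w) ∧ ∀ p, p ≤ t.v 9 ↔ p = 0 ∨ ∃ x y,
      x ≤ s.a 3 0 u ∧ y ≤ s.a 3 0 v ∧ x + y < m ∧ p ≤ s.a 4 x y)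
    (by rw [St.setVar_v, if_neg (by decide)]; omega) ?_ ?_ ?_
  · simp [St.setVar_v]
  · rintro m hm t ft ⟨ht1, ht2, ht3⟩
    rw [St.setVar_v, if_neg (by decide), h2] at hm
    have g2 : t.v 2 = n + 1 := by rw [ft.1 2 rfl, St.setVar_v, if_neg (by decide), h2]
    refine .seq (Cmd.Tr.frame (Q := fun t => ∀ p, p ≤ t.v 9 ↔ p = 0 ∨ ∃ x y,
      x ≤ s.a 3 0 u ∧ y ≤ s.a 3 0 v ∧ x + y < m + 1 ∧ p ≤ s.a 4 x y) ?_ ?_)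
    · refine .loop (fun l t => ∀ p, p ≤ t.v 9 ↔ p = 0 ∨ ∃ x y,
        x ≤ s.a 3 0 u ∧ y ≤ s.a 3 0 v ∧ (x + y < m ∨ x < l ∧ x + y = m) ∧ p ≤ s.a 4 x y) ?_ ?_ ?_ ?_
      · rw [St.setVar_v, if_neg (by decide), g2]
      · simpa [St.setVar_v] using ht3
      · intro l hl t' ft' ht'
        rw [St.setVar_v, if_neg (by decide), g2] at hl
        have e3 : (t'.setVar 4 l).v 3 = m := by
          rw [St.setVar_v, if_neg (by decide), ft'.1 3 rfl, St.setVar_v, if_pos rfl]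
        have e4 : (t'.setVar 4 l).v 4 = l := by rw [St.setVar_v, if_pos rfl]
        have e6 : (t'.setVar 4 l).v 6 = u := by
          rw [St.setVar_v, if_neg (by decide), ft'.1 6 rfl, St.setVar_v, if_neg (by decide),
            ft.1 6 rfl, St.setVar_v, if_neg (by decide), h6]
        have e7 : (t'.setVar 4 l).v 7 = v := by
          rw [St.setVar_v, if_neg (by decide), ft'.1 7 rfl, St.setVar_v, if_neg (by decide),
            ft.1 7 rfl, St.setVar_v, if_neg (by decide), h7]
        have e9 : (t'.setVar 4 l).v 9 = t'.v 9 := by rw [St.setVar_v, if_neg (by decide)]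
        have a3 : (t'.setVar 4 l).a 3 = s.a 3 := (ft'.2 3 rfl).trans (ft.2 3 rfl)
        have a4 : (t'.setVar 4 l).a 4 = s.a 4 := (ft'.2 4 rfl).trans (ft.2 4 rfl)
        rw [← e9] at ht'
        generalize t'.setVar 4 l = q at *
        -- Every failed test means that the pair (l, m − l) is inadmissible or no improvement, so
        -- the accumulator already satisfies the next invariant.
        have hno : ¬ (l ≤ m ∧ l ≤ s.a 3 0 u ∧ m - l ≤ s.a 3 0 v ∧ q.v 9 < s.a 4 l (m - l)) →
            ∀ p, p ≤ q.v 9 ↔ p = 0 ∨ ∃ x y, x ≤ s.a 3 0 u ∧ y ≤ s.a 3 0 v ∧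
              (x + y < m ∨ x < l + 1 ∧ x + y = m) ∧ p ≤ s.a 4 x y := by
          intro hn p
          rw [ht']
          constructor
          · rintro (h | ⟨x, y, h1, h2, h3, h4⟩)
            · exact Or.inl h
            · exact Or.inr ⟨x, y, h1, h2, by omega, h4⟩
          · rintro (h | ⟨x, y, h1, h2, h3, h4⟩)
            · exact Or.inl h
            · by_cases hx : x = l ∧ x + y = m
              · obtain ⟨rfl, rfl⟩ := hx
                rw [Nat.add_sub_cancel_left] at hn
                exact (ht' p).1 (by omega)
              · exact Or.inr ⟨x, y, h1, h2, by omega, h4⟩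
        refine .when (by simp) (by simp [e3]; omega) (fun h1 => ?_) fun h1 => hno fun h => h1 ?_
        swap
        · simpa [e3, e4] using h.1
        refine .when (by simp) (by simp [InRange, e6, a3]; omega) (fun h2 => ?_)
          fun h2 => hno fun h => h2 ?_
        swap
        · simp [e4, e6, a3]
          omega
        refine .when (by simp) (by simp [InRange, e7, a3]; omega) (fun h3 => ?_)
          fun h3 => hno fun h => h3 ?_
        swap
        · simp [e3, e4, e7, a3]
          omega
        have hok : (ld 4 (var 4) (sub (var 3) (var 4))).Ok n B q := by
          simp [InRange, e3, e4]
          omega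
        refine .when (by simp) hok (fun h4 => ?_) fun h4 => hno fun h => h4 ?_
        swap
        · simpa [e3, e4, a4] using h.2.2.2
        simp only [Expr.eval, e3, e4, e6, e7, a3, a4] at h1 h2 h3 h4
        refine .assign hok fun p => ?_
        simp only [St.setVar_v, Expr.eval, e3, e4, a4, if_true]
        constructor
        · intro hp
          exact Or.inr ⟨l, m - l, by omega, by omega, by omega, hp⟩
        · rintro (rfl | ⟨x, y, g1, g2, g3, g4⟩)
          · omega
          · by_cases hx : x = l ∧ x + y = m
            · obtain ⟨rfl, rfl⟩ := hx
              rwa [Nat.add_sub_cancel_left]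
            · have := (ht' p).2 (Or.inr ⟨x, y, g1, g2, by omega, g4⟩)
              omega
      · intro t' ft' ht' p
        rw [St.setVar_v, if_neg (by decide), g2] at ht'
        rw [St.setVar_v, if_neg (by decide), ht']
        refine or_congr_right (exists_congr fun x => exists_congr fun y => ?_)
        refine and_congr_right fun _ => and_congr_right fun _ => and_congr_left fun _ => ?_
        omega
    · intro t' ft' ht'
      have e3 : t'.v 3 = m := by rw [ft'.1 3 rfl, St.setVar_v, if_pos rfl]
      have e6 : t'.v 6 = u := by
        rw [ft'.1 6 rfl, St.setVar_v, if_neg (by decide), ft.1 6 rfl, St.setVar_v,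
          if_neg (by decide), h6]
      have a2 : t'.a 2 = t.a 2 := ft'.2 2 rfl
      refine .store trivial trivial trivial (by simp [InRange, e3, e6]; omega) ⟨?_, ?_, ht'⟩
      · intro d hd p
        simp only [St.setArr_a, Expr.eval, e3, e6, a2, true_and]
        split_ifs with h
        · subst h
          rw [ht']
          simp only [Nat.lt_succ_iff]
        · exact ht1 d (by omega) p
      · intro w hw
        funext d
        simp only [St.setArr_a, Expr.eval, e3, e6, a2, ht2 w hw]
        simp [hw]
  · rintro t ft ⟨ht1, ht2, -⟩
    rw [St.setVar_v, if_neg (by decide), h2] at ht1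
    exact ⟨fun d hd p => ht1 d (by omega) p, ht2⟩

theorem maxTables_tr {u v : ℕ} (h2 : s.v 2 = n + 1) (h6 : s.v 6 = u) (h7 : s.v 7 = v)
    (hu : u < n) (hv : v < n) (huv : u ≠ v) :
    maxTables.Tr n B s fun t => (∀ d ≤ n, t.a 2 u d = max (s.a 2 u d) (s.a 2 v d)) ∧
      ∀ w ≠ u, t.a 2 w = s.a 2 w := by
  refine .loop (fun m t => (∀ d, t.a 2 u d = if d < m then max (s.a 2 u d) (s.a 2 v d)
      else s.a 2 u d) ∧ ∀ w ≠ u, t.a 2 w = s.a 2 w) (by omega) (by simp) ?_ ?_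
  · rintro m hm t ft ⟨ht1, ht2⟩
    have e3 : (t.setVar 3 m).v 3 = m := by rw [St.setVar_v, if_pos rfl]
    have e6 : (t.setVar 3 m).v 6 = u := by rw [St.setVar_v, if_neg (by decide), ft.1 6 rfl, h6]
    have e7 : (t.setVar 3 m).v 7 = v := by rw [St.setVar_v, if_neg (by decide), ft.1 7 rfl, h7]
    have au : t.a 2 u m = s.a 2 u m := by rw [ht1, if_neg (by omega)]
    have av : t.a 2 v = s.a 2 v := ht2 v huv.symm
    have hin : ∀ w < n, InRange n 2 w m := fun w hw => by
      rw [InRange, if_neg (by decide)]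
      omega
    refine .when (by simpa [e3, e6] using hin u hu) (by simpa [e3, e7] using hin v hv)
      (fun h => ?_) fun h => ?_
    · simp only [Expr.eval, e3, e6, e7, St.setVar_a, au, av] at h
      refine .store trivial trivial (by simpa [e3, e7] using hin v hv)
        (by simpa [e3, e6] using hin u hu) ⟨fun d => ?_, fun w hw => ?_⟩
      · simp only [St.setArr_a, Expr.eval, e3, e6, e7, St.setVar_a, true_and, av, ht1]
        by_cases hd : d = m
        · subst hd
          simp [h.le]
        · have : d < m + 1 ↔ d < m := by omega
          simp only [hd, if_false, this]
      · funext d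
        simp only [St.setArr_a, Expr.eval, e3, e6, St.setVar_a, ht2 w hw]
        simp [hw]
    · simp only [Expr.eval, e3, e6, e7, St.setVar_a, au, av] at h
      refine ⟨fun d => ?_, ht2⟩
      rw [St.setVar_a, ht1]
      by_cases hd : d = m
      · subst hd
        simp [not_lt.1 h]
      · have : d < m + 1 ↔ d < m := by omega
        simp only [this]
  · rintro t ft ⟨ht1, ht2⟩
    exact ⟨fun d hd => by rw [St.setVar_a, ht1, if_pos (by omega)], ht2⟩

theorem mergeSizes_tr {u v : ℕ} (h6 : s.v 6 = u) (h7 : s.v 7 = v) (hu : u < n) (hv : v < n)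
    (hB : s.a 3 0 u + s.a 3 0 v ≤ B) :
    mergeSizes.Tr n B s fun t => ∀ w, t.a 3 0 w =
      if w = v then 0 else if w = u then s.a 3 0 u + s.a 3 0 v else s.a 3 0 w := by
  have hin : ∀ w < n, InRange n 3 0 w := fun w hw => by
    rw [InRange, if_neg (by decide)]
    omega
  refine .seq (.store (by simp) trivial ?_ ?_ (.store (by simp) trivial (by simp) ?_ fun w => ?_))
  · simpa [h6, h7] using ⟨hin u hu, hin v hv, hB⟩
  · simpa [h6] using hin u hu
  · simpa [h7] using hin v hv
  · simp only [St.setArr_a, St.setArr_v, Expr.eval, h6, h7, true_and]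

end WordRAM

/-! ### Partitions into modules -/

section Modules

set_option linter.unusedSectionVars false

variable {V : Type*} [DecidableEq V] {G : SimpleGraph V}

open Classical in
/-- Entry of the adjacency matrix. -/
noncomputable def adjVal (G : SimpleGraph V) (u v : V) : ℕ := if G.Adj u v then 1 else 0

/-- Whether `w` is adjacent to exactly one of `u`, `v`. -/
noncomputable def adjDiff (G : SimpleGraph V) (u v w : V) : ℕ :=
  (adjVal G u w - adjVal G v w) + (adjVal G v w - adjVal G u w)

theorem adjVal_le_one (G : SimpleGraph V) (u v : V) : adjVal G u v ≤ 1 := by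
  rw [adjVal]
  split_ifs <;> omega

/-- The terms for u and for v both equal the adjacency entry of u and v. The inequality thus says
that all remaining terms vanish. -/
theorem sum_adjDiff_lt_iff {L : Finset V} {u v : V} (hu : u ∈ L) (hv : v ∈ L) (huv : u ≠ v) :
    ∑ w ∈ L, adjDiff G u v w < adjVal G u v + adjVal G u v + 1 ↔ TwinsIn G L u v := by
  have hv' : v ∈ L.erase u := Finset.mem_erase.2 ⟨huv.symm, hv⟩
  rw [← Finset.add_sum_erase L _ hu, ← Finset.add_sum_erase _ _ hv']
  have h1 : adjDiff G u v u = adjVal G u v := by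
    by_cases h : G.Adj u v
    · simp [adjDiff, adjVal, h, h.symm]
    · simpa [adjDiff, adjVal, h] using fun h' => h (SimpleGraph.Adj.symm h')
  have h2 : adjDiff G u v v = adjVal G u v := by
    simp [adjDiff, adjVal]
  have h3 : (∑ w ∈ (L.erase u).erase v, adjDiff G u v w = 0) ↔ TwinsIn G L u v := by
    rw [Finset.sum_eq_zero_iff]
    refine ⟨fun h w hw hwu hwv => ?_, fun h w hw => ?_⟩
    · have := h w (by simp [hw, hwu, hwv])
      by_cases a : G.Adj u w <;> by_cases b : G.Adj v w <;> simp_all [adjDiff, adjVal]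
    · simp only [Finset.mem_erase] at hw
      have := h w hw.2.2 hw.2.1 hw.1
      by_cases hb : G.Adj v w <;> simp [adjDiff, adjVal, this, hb]
  rw [h1, h2, ← h3]
  omega

/-- The sets `M u`, `u ∈ L`, are modules that partition `S`, and `u` represents `M u`. -/
structure IsModularPartition (G : SimpleGraph V) (S L : Finset V) (M : V → Finset V) : Prop where
  mem_self : ∀ u ∈ L, u ∈ M u
  sub : ∀ u ∈ L, M u ⊆ S
  disj : ∀ u ∈ L, ∀ v ∈ L, u ≠ v → Disjoint (M u) (M v)
  cover : ∀ w ∈ S, ∃ u ∈ L, w ∈ M u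
  adj : ∀ u ∈ L, ∀ v ∈ L, u ≠ v → ∀ a ∈ M u, ∀ b ∈ M v, (G.Adj a b ↔ G.Adj u v)

theorem isModularPartition_singletons (G : SimpleGraph V) (S : Finset V) :
    IsModularPartition G S S fun u => {u} where
  mem_self := by simp
  sub := by simp
  disj := by simp
  cover := by simp
  adj := by
    simp only [Finset.mem_singleton]
    rintro u - v - - a rfl b rfl
    rfl

/-- Twin representatives look alike to every other representative, hence their modules look alike to
every other module, and u can represent the union. -/
theorem IsModularPartition.merge {S L : Finset V} {M : V → Finset V}
    (h : IsModularPartition G S L M) {u v : V} (hu : u ∈ L) (hv : v ∈ L) (huv : u ≠ v)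
    (ht : TwinsIn G L u v) :
    IsModularPartition G S (L.erase v) (Function.update M u (M u ∪ M v)) := by
  have hone : ∀ w ∈ L, w ≠ u → w ≠ v → Disjoint (M u ∪ M v) (M w) ∧
      ∀ a ∈ M u ∪ M v, ∀ b ∈ M w, (G.Adj a b ↔ G.Adj u w) := by
    intro w hw hwu hwv
    refine ⟨Finset.disjoint_union_left.2 ⟨h.disj u hu w hw hwu.symm, h.disj v hv w hw hwv.symm⟩,
      fun a ha b hb => ?_⟩
    rcases Finset.mem_union.1 ha with ha | ha
    · exact h.adj u hu w hw hwu.symm a ha b hb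
    · rw [ht w hw hwu hwv]
      exact h.adj v hv w hw hwv.symm a ha b hb
  refine ⟨?_, ?_, ?_, ?_, ?_⟩
  · intro w hw
    rw [Finset.mem_erase] at hw
    by_cases hwu : w = u
    · subst hwu
      simp [h.mem_self w hu]
    · rw [Function.update_of_ne hwu]
      exact h.mem_self w hw.2
  · intro w hw
    rw [Finset.mem_erase] at hw
    by_cases hwu : w = u
    · subst hwu
      rw [Function.update_self]
      exact Finset.union_subset (h.sub w hu) (h.sub v hv)
    · rw [Function.update_of_ne hwu]
      exact h.sub w hw.2
  · intro w hw w' hw' hne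
    rw [Finset.mem_erase] at hw hw'
    by_cases hwu : w = u
    · subst hwu
      rw [Function.update_self, Function.update_of_ne hne.symm]
      exact (hone w' hw'.2 hne.symm hw'.1).1
    · by_cases hwu' : w' = u
      · subst hwu'
        rw [Function.update_self, Function.update_of_ne hne]
        exact (hone w hw.2 hne hw.1).1.symm
      · rw [Function.update_of_ne hwu, Function.update_of_ne hwu']
        exact h.disj w hw.2 w' hw'.2 hne
  · intro w hw
    obtain ⟨x, hx, hwx⟩ := h.cover w hw
    by_cases hxv : x = v
    · subst hxv
      exact ⟨u, Finset.mem_erase.2 ⟨huv, hu⟩, by simp [hwx]⟩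
    · refine ⟨x, Finset.mem_erase.2 ⟨hxv, hx⟩, ?_⟩
      by_cases hxu : x = u
      · subst hxu
        simp [hwx]
      · rwa [Function.update_of_ne hxu]
  · intro w hw w' hw' hne a ha b hb
    rw [Finset.mem_erase] at hw hw'
    by_cases hwu : w = u
    · subst hwu
      rw [Function.update_self] at ha
      rw [Function.update_of_ne hne.symm] at hb
      exact (hone w' hw'.2 hne.symm hw'.1).2 a ha b hb
    · by_cases hwu' : w' = u
      · subst hwu'
        rw [Function.update_self] at hb
        rw [Function.update_of_ne hne] at ha
        rw [G.adj_comm a, G.adj_comm w]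
        exact (hone w hw.2 hne hw.1).2 b hb a ha
      · rw [Function.update_of_ne hwu] at ha
        rw [Function.update_of_ne hwu'] at hb
        exact h.adj w hw.2 w' hw'.2 hne a ha b hb

theorem IsTable.congr {S : Finset V} {m : ℕ} {g g' : ℕ → ℕ} (h : IsTable G S m g)
    (hg : ∀ d ≤ m, g' d = g d) : IsTable G S m g' := fun d hd p => by
  rw [hg d hd]
  exact h d hd p

end Modules

namespace WordRAM

open WordRAM.Expr WordRAM.Cmd

variable {n B : ℕ} {s : St}

/-! ### Verification of the program -/

/-- Between two modules adjacency is constant, so the single entry for their representatives decides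
between join and disjoint union. -/
theorem mergeTables_tr {H : SimpleGraph ℕ} {S T : Finset ℕ} {u v : ℕ} (h2 : s.v 2 = n + 1)
    (h6 : s.v 6 = u) (h7 : s.v 7 = v) (hu : u < n) (hv : v < n) (huv : u ≠ v)
    (hB : 3 * (n + 1) ≤ B) (hA : s.a 0 u v = adjVal H u v) (hSc : s.a 3 0 u = S.card)
    (hTc : s.a 3 0 v = T.card) (hSn : S.card ≤ n) (hTn : T.card ≤ n) (hST : Disjoint S T)
    (hadj : ∀ a ∈ S, ∀ b ∈ T, (H.Adj a b ↔ H.Adj u v)) (hS : IsTable H S n (s.a 2 u))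
    (hT : IsTable H T n (s.a 2 v)) :
    mergeTables.Tr n B s fun t => IsTable H (S ∪ T) n (t.a 2 u) ∧
      ∀ w ≠ u, t.a 2 w = s.a 2 w := by
  refine .ite (by simp) (by simp [InRange, h6, h7, hu, hv]) (fun h => ?_) fun h => ?_
  · have ha : H.Adj u v := by
      by_contra hn
      simp [h6, h7, hA, adjVal, hn] at h
    refine .seq ((fillPairs_tr h2 h6 h7 hu hv hB (fun d hd => hS.le_self hd)
      fun d hd => hT.le_self hd).frame fun t ft ht => ?_)
    have t3 : t.a 3 = s.a 3 := ft.2 3 rfl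
    have t2 : t.a 2 = s.a 2 := ft.2 2 rfl
    refine (collectPairs_tr ((ft.1 2 rfl).trans h2) ((ft.1 6 rfl).trans h6)
      ((ft.1 7 rfl).trans h7) hu hv (by omega) (by rw [t3, hSc]; exact hSn)
      (by rw [t3, hTc]; exact hTn)).frame fun t' _ ht' => ?_
    rw [t3, t2, hSc, hTc] at ht'
    refine ⟨hS.join hT hST (fun a ha' b hb => (hadj a ha' b hb).2 ha) fun d hd p => ?_, ht'.2⟩
    rw [ht'.1 d hd p]
    refine or_congr_right (exists_congr fun x => exists_congr fun y => ?_)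
    refine and_congr_right fun hx => and_congr_right fun hy => and_congr_right fun _ => ?_
    rw [ht x (hx.trans hSn) y (hy.trans hTn)]
  · have ha : ¬ H.Adj u v := by
      intro hn
      simp [h6, h7, hA, adjVal, hn] at h
    refine (maxTables_tr h2 h6 h7 hu hv huv).frame fun t _ ht => ?_
    exact ⟨(hS.union hT fun a ha' b hb h => ha ((hadj a ha' b hb).1 h)).congr ht.1, ht.2⟩

/-- The invariant of the main loop. -/
structure RoundInv (n : ℕ) (H : SimpleGraph ℕ) (L : Finset ℕ) (M : ℕ → Finset ℕ) (s : St) :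
    Prop where
  size : s.v 0 = n
  width : s.v 2 = n + 1
  adj : ∀ i < n, ∀ j < n, s.a 0 i j = adjVal H i j
  sub : L ⊆ Finset.range n
  part : IsModularPartition H (Finset.range n) L M
  diff : ∀ i < n, ∀ j < n, s.a 1 i j = ∑ w ∈ L, adjDiff H i j w
  table : ∀ u ∈ L, IsTable H (M u) n (s.a 2 u)
  card : ∀ u < n, s.a 3 0 u = if u ∈ L then (M u).card else 0

theorem diffExpr_eval {H : SimpleGraph ℕ} (hadj : ∀ i < n, ∀ j < n, s.a 0 i j = adjVal H i j)
    (hB : 2 ≤ B) {i j k : ℕ} {x y z : ℕ} (hx : s.v x = i) (hy : s.v y = j) (hz : s.v z = k)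
    (hi : i < n) (hj : j < n) (hk : k < n) :
    (diffExpr (var x) (var y) (var z)).Ok n B s ∧
      (diffExpr (var x) (var y) (var z)).eval s = adjDiff H i j k := by
  have h1 := adjVal_le_one H i k
  have h2 := adjVal_le_one H j k
  simp [diffExpr, InRange, hx, hy, hz, hadj i hi k hk, hadj j hj k hk, hi, hj, hk, adjDiff]
  omega

theorem oneRound_tr {H : SimpleGraph ℕ} (hH : IsP4Free H) {L : Finset ℕ} {M : ℕ → Finset ℕ}
    (hs : RoundInv n H L M s) (hL : 2 ≤ L.card) (h0 : 0 ∈ L) (hB : 3 * (n + 1) ≤ B) :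
    oneRound.Tr n B s fun t => ∃ L' M', RoundInv n H L' M' t ∧ 0 ∈ L' ∧
      L'.card + 1 = L.card := by
  have hpos : ∀ i ∈ L, i < n ∧ 0 < s.a 3 0 i := fun i hi => by
    have hin := Finset.mem_range.1 (hs.sub hi)
    rw [hs.card i hin, if_pos hi]
    exact ⟨hin, Finset.card_pos.2 ⟨i, hs.part.mem_self i hi⟩⟩
  -- Twins exist among the representatives because absence of induced paths holds for any set of
  -- vertices; they are ordered so that i < j.
  have hex : ∃ i < n, ∃ j < n, i < j ∧ 0 < s.a 3 0 i ∧ 0 < s.a 3 0 j ∧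
      s.a 1 i j < s.a 0 i j + s.a 0 i j + 1 := by
    have key : ∀ i ∈ L, ∀ j ∈ L, i < j → TwinsIn H L i j → ∃ i < n, ∃ j < n, i < j ∧
        0 < s.a 3 0 i ∧ 0 < s.a 3 0 j ∧ s.a 1 i j < s.a 0 i j + s.a 0 i j + 1 := by
      intro i hi j hj hij ht
      refine ⟨i, (hpos i hi).1, j, (hpos j hj).1, hij, (hpos i hi).2, (hpos j hj).2, ?_⟩
      rw [hs.diff i (hpos i hi).1 j (hpos j hj).1, hs.adj i (hpos i hi).1 j (hpos j hj).1]
      exact (sum_adjDiff_lt_iff hi hj hij.ne).2 ht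
    obtain ⟨i, hi, j, hj, hij, ht⟩ := hH.exists_twins L hL
    rcases lt_or_gt_of_ne hij with h | h
    · exact key i hi j hj h ht
    · exact key j hj i hi h fun w hw hwj hwi => (ht w hw hwi hwj).symm
  refine .seq ((findTwins_tr hs.size (by omega) fun i hi j hj =>
    hs.adj i hi j hj ▸ adjVal_le_one H i j).frame fun t ft ht => ?_)
  obtain ⟨huv, hv, hu0, hv0, hlt⟩ := ht hex
  obtain ⟨u, hu6⟩ : ∃ u, t.v 6 = u := ⟨_, rfl⟩
  obtain ⟨v, hv7⟩ : ∃ v, t.v 7 = v := ⟨_, rfl⟩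
  rw [hu6] at huv hu0 hlt
  rw [hv7] at huv hv hv0 hlt
  have hu : u < n := huv.trans hv
  have huL : u ∈ L := by
    by_contra h
    simp [hs.card u hu, h] at hu0
  have hvL : v ∈ L := by
    by_contra h
    simp [hs.card v hv, h] at hv0
  rw [hs.diff u hu v hv, hs.adj u hu v hv, sum_adjDiff_lt_iff huL hvL huv.ne] at hlt
  have cu : s.a 3 0 u = (M u).card := by rw [hs.card u hu, if_pos huL]
  have cv : s.a 3 0 v = (M v).card := by rw [hs.card v hv, if_pos hvL]
  have hdis := hs.part.disj u huL v hvL huv.ne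
  have hcard : (M u).card + (M v).card ≤ n := by
    rw [← Finset.card_union_of_disjoint hdis]
    simpa using Finset.card_le_card
      (Finset.union_subset (hs.part.sub u huL) (hs.part.sub v hvL))
  have t0 : t.a 0 = s.a 0 := ft.2 0 rfl
  have t1 : t.a 1 = s.a 1 := ft.2 1 rfl
  have t2 : t.a 2 = s.a 2 := ft.2 2 rfl
  have t3 : t.a 3 = s.a 3 := ft.2 3 rfl
  refine .seq ((mergeTables_tr (H := H) (S := M u) (T := M v) ((ft.1 2 rfl).trans hs.width) hu6
    hv7 hu hv huv.ne hB (by rw [t0, hs.adj u hu v hv]) (by rw [t3, cu]) (by rw [t3, cv])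
    (by omega) (by omega) hdis (hs.part.adj u huL v hvL huv.ne) (by rw [t2]; exact hs.table u huL)
    (by rw [t2]; exact hs.table v hvL)).frame fun q fq hq => ?_)
  have q3 : q.a 3 = s.a 3 := (fq.2 3 rfl).trans t3
  have q6 : q.v 6 = u := (fq.1 6 rfl).trans hu6
  have q7 : q.v 7 = v := (fq.1 7 rfl).trans hv7
  refine .seq ((mergeSizes_tr q6 q7 hu hv (by rw [q3]; omega)).frame fun r fr hr => ?_)
  have r0 : r.a 0 = s.a 0 := ((fr.2 0 rfl).trans (fq.2 0 rfl)).trans t0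
  have r1 : r.a 1 = s.a 1 := ((fr.2 1 rfl).trans (fq.2 1 rfl)).trans t1
  have r2 : r.a 2 = q.a 2 := fr.2 2 rfl
  have r7 : r.v 7 = v := (fr.1 7 rfl).trans q7
  have rn : r.v 0 = n := by rw [fr.1 0 rfl, fq.1 0 rfl, ft.1 0 rfl, hs.size]
  have rw' : r.v 2 = n + 1 := by rw [fr.1 2 rfl, fq.1 2 rfl, ft.1 2 rfl, hs.width]
  refine (updateDiff_tr (fun i j => ∑ w ∈ L.erase v, adjDiff H i j w) rn ?_).frame
    fun z fz hz => ?_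
  · intro z fz i hi j hj z4 z5 z1
    have hz0 : z.a 0 = s.a 0 := (fz.2 0 rfl).trans r0
    obtain ⟨o1, o2⟩ := diffExpr_eval (s := z) (B := B) (H := H) (fun i hi j hj => by
      rw [hz0, hs.adj i hi j hj]) (by omega) z4 z5 ((fz.1 7 rfl).trans r7) hi hj hv
    refine ⟨⟨by simp [InRange, z4, z5]; omega, o1⟩, ?_⟩
    rw [Expr.eval, o2]
    simp only [Expr.eval, z4, z5, z1, r1, hs.diff i hi j hj]
    rw [← Finset.add_sum_erase L _ hvL, Nat.add_sub_cancel_left]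
  · have z2 : z.a 2 = q.a 2 := (fz.2 2 rfl).trans r2
    have z3 : z.a 3 = r.a 3 := fz.2 3 rfl
    refine ⟨L.erase v, Function.update M u (M u ∪ M v), ⟨?_, ?_, ?_, ?_, ?_, hz, ?_, ?_⟩, ?_, ?_⟩
    · rw [fz.1 0 rfl, rn]
    · rw [fz.1 2 rfl, rw']
    · intro i hi j hj
      rw [fz.2 0 rfl, r0, hs.adj i hi j hj]
    · exact (Finset.erase_subset _ _).trans hs.sub
    · exact hs.part.merge huL hvL huv.ne hlt
    · intro w hw
      rw [Finset.mem_erase] at hw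
      rw [z2]
      by_cases hwu : w = u
      · subst hwu
        rw [Function.update_self]
        exact hq.1
      · rw [Function.update_of_ne hwu, hq.2 w hwu, t2]
        exact hs.table w hw.2
    · intro w hw
      rw [z3, hr, q3]
      by_cases hwv : w = v
      · simp [hwv]
      · by_cases hwu : w = u
        · subst hwu
          simp [hwv, huL, cu, cv, Finset.card_union_of_disjoint hdis]
        · simp [hwv, hwu, hs.card w hw]
    -- The retired v exceeds u, so it is not 0.
    · exact Finset.mem_erase.2 ⟨by omega, h0⟩
    · exact Finset.card_erase_add_one hvL

theorem initAll_tr {H : SimpleGraph ℕ} (h0 : s.v 0 = n) (h2 : s.v 2 = n + 1)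
    (hA : ∀ i < n, ∀ j < n, s.a 0 i j = adjVal H i j) (h1 : s.a 1 = 0) (hz : s.a 2 = 0)
    (h3 : s.a 3 = 0) (hB : 3 * (n + 1) ≤ B) :
    initAll.Tr n B s fun t => RoundInv n H (Finset.range n) (fun u => {u}) t ∧
      (n = 0 → t.a 2 0 0 = 0) := by
  refine .loop (fun m t => (∀ i < n, ∀ j < n, t.a 1 i j = ∑ w ∈ Finset.range m, adjDiff H i j w) ∧
      (∀ u < m, ∀ d ≤ n, t.a 2 u d = if 0 < d then 1 else 0) ∧ (∀ u, m ≤ u → t.a 2 u = 0) ∧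
      ∀ u, t.a 3 0 u = if u < m then 1 else 0) (by omega) ?_ ?_ ?_
  · simp [h1, hz, h3]
  · rintro m hm t ft ⟨i1, i2, i3, i4⟩
    have hmn : m < n := by omega
    have e3 : (t.setVar 3 m).v 3 = m := by rw [St.setVar_v, if_pos rfl]
    have e0 : (t.setVar 3 m).v 0 = n := by rw [St.setVar_v, if_neg (by decide), ft.1 0 rfl, h0]
    have e2 : (t.setVar 3 m).v 2 = n + 1 := by rw [St.setVar_v, if_neg (by decide), ft.1 2 rfl, h2]
    have a0 : (t.setVar 3 m).a 0 = s.a 0 := ft.2 0 rfl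
    rw [← St.setVar_a t 3 m] at i1 i2 i3 i4
    generalize t.setVar 3 m = q at *
    refine .seq (.store (by simp) trivial (by simp; omega)
      (by simp [InRange, e3]; omega) (.seq ?_))
    simp only [Expr.eval, e3]
    have g2 : (q.setArr 3 0 m 1).a 2 = q.a 2 := rfl
    have g1 : (q.setArr 3 0 m 1).a 1 = q.a 1 := rfl
    have g0 : (q.setArr 3 0 m 1).a 0 = q.a 0 := rfl
    have g3 : ∀ u, (q.setArr 3 0 m 1).a 3 0 u = if u < m + 1 then 1 else 0 := by
      intro u
      simp only [St.setArr_a, true_and, i4]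
      split_ifs <;> omega
    rw [← St.setArr_v q 3 0 m 1] at e0 e2 e3
    generalize q.setArr 3 0 m 1 = r at *
    refine (initTable_tr e2 (by omega) (by omega) (by rw [e3, g2, i3 m le_rfl])).frame
      fun z fz ⟨hz1, hz2⟩ => ?_
    rw [e3] at hz1 hz2
    have z1 : z.a 1 = q.a 1 := (fz.2 1 rfl).trans g1
    have z0 : z.a 0 = s.a 0 := (fz.2 0 rfl).trans (g0.trans a0)
    have z3 : z.v 3 = m := (fz.1 3 rfl).trans e3
    refine (updateDiff_tr (fun i j => ∑ w ∈ Finset.range (m + 1), adjDiff H i j w)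
      ((fz.1 0 rfl).trans e0) ?_).frame fun y fy hy => ⟨hy, ?_, ?_, ?_⟩
    · intro y fy i hi j hj y4 y5 y1
      have y0 : y.a 0 = s.a 0 := (fy.2 0 rfl).trans z0
      obtain ⟨o1, o2⟩ := diffExpr_eval (s := y) (B := B) (H := H) (fun i hi j hj => by
        rw [y0, hA i hi j hj]) (by omega) y4 y5 ((fy.1 3 rfl).trans z3) hi hj hmn
      have hle : ∀ w, adjDiff H i j w ≤ 1 := fun w => by
        have := adjVal_le_one H i w
        have := adjVal_le_one H j w
        rw [adjDiff]
        omega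
      have hsum : ∑ w ∈ Finset.range (m + 1), adjDiff H i j w ≤ m + 1 := by
        simpa using Finset.sum_le_sum (s := Finset.range (m + 1)) fun w _ => hle w
      have hev : (ld 1 (var 4) (var 5)).eval y + (diffExpr (var 4) (var 5) (var 3)).eval y =
          ∑ w ∈ Finset.range (m + 1), adjDiff H i j w := by
        rw [o2]
        simp only [Expr.eval, y4, y5, y1, z1, i1 i hi j hj]
        rw [Finset.sum_range_succ]
      refine ⟨⟨by simp [InRange, y4, y5]; omega, o1, ?_⟩, hev⟩
      rw [hev]
      omega
    · intro u hu d hd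
      rw [fy.2 2 rfl]
      by_cases hum : u = m
      · rw [hum, hz1 d hd]
      · rw [hz2 u hum, g2, i2 u (by omega) d hd]
    · intro u hu
      rw [fy.2 2 rfl, hz2 u (by omega), g2, i3 u (by omega)]
    · intro u
      rw [fy.2 3 rfl, fz.2 3 rfl, g3]
  · rintro t ft ⟨i1, i2, i3, i4⟩
    rw [h0] at i1 i2 i3 i4
    refine ⟨⟨?_, ?_, ?_, subset_rfl, isModularPartition_singletons _ _, i1, ?_, ?_⟩, ?_⟩
    · rw [St.setVar_v, if_neg (by decide), ft.1 0 rfl, h0]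
    · rw [St.setVar_v, if_neg (by decide), ft.1 2 rfl, h2]
    · intro i hi j hj
      rw [St.setVar_a, ft.2 0 rfl, hA i hi j hj]
    · intro u hu
      exact (isTable_singleton u n).congr fun d hd => i2 u (Finset.mem_range.1 hu) d hd
    · intro u hu
      simp [i4, hu]
    · rintro rfl
      simp [i3 0 le_rfl]

theorem hadwigerCmd_tr {H : SimpleGraph ℕ} (hH : IsP4Free H) (h0 : s.v 0 = n)
    (hA : ∀ i < n, ∀ j < n, s.a 0 i j = adjVal H i j) (h1 : s.a 1 = 0) (h2 : s.a 2 = 0)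
    (h3 : s.a 3 = 0) (hB : 3 * (n + 1) ≤ B) :
    hadwigerCmd.Tr n B s fun t => (∀ p, HasModel H (Finset.range n) n p ↔ p ≤ t.v 1) ∧
      t.v 10 = if s.v 1 ≤ t.v 1 then 1 else 0 := by
  refine .seq (.assign (by simp [h0]; omega) (.seq ?_))
  refine (initAll_tr (s := s.setVar 2 _) (H := H) (n := n) ?_ ?_ hA h1 h2 h3 hB).frame
    fun t ft ⟨ht, ht0⟩ => .seq ?_
  · rw [St.setVar_v, if_neg (by decide), h0]
  · simp [St.setVar_v, h0]
  have tv1 : t.v 1 = s.v 1 := by rw [ft.1 1 rfl, St.setVar_v, if_neg (by decide)]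
  refine Cmd.Tr.frame (Q := fun q => ∃ L M, RoundInv n H L M q ∧ (0 < n → 0 ∈ L) ∧
    L.card = n - (n - 1) ∧ (n = 0 → q.a 2 0 0 = 0)) ?_ ?_
  -- Truncated subtraction makes n − (m − 1) equal n for both m = 0 and m = 1, in accordance with
  -- the idle round 0.
  · refine .loop (fun m q => ∃ L M, RoundInv n H L M q ∧ (0 < n → 0 ∈ L) ∧
      L.card = n - (m - 1) ∧ (n = 0 → q.a 2 0 0 = 0)) (by rw [ht.size]; omega)
      ⟨_, _, ht, by simp, by simp, ht0⟩ ?_ ?_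
    · rintro m hm q fq ⟨L, M, hq, hL0, hLc, hn0⟩
      rw [ht.size] at hm
      have hq' : RoundInv n H L M (q.setVar 8 m) :=
        ⟨hq.size, hq.width, hq.adj, hq.sub, hq.part, hq.diff, hq.table, hq.card⟩
      refine .when (by simp) (by simp) (fun h => ?_) fun h => ?_
      · simp only [Expr.eval, St.setVar_v, if_true] at h
        refine (oneRound_tr hH hq' (by omega) (hL0 (by omega)) hB).frame
          fun z _ ⟨L', M', hz, hz0, hzc⟩ => ⟨L', M', hz, fun _ => hz0, by omega, by omega⟩
      · simp only [Expr.eval, St.setVar_v, if_true] at h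
        exact ⟨L, M, hq', hL0, by omega, hn0⟩
    · rintro q fq ⟨L, M, hq, hL⟩
      rw [ht.size] at hL
      exact ⟨L, M, ⟨hq.size, hq.width, hq.adj, hq.sub, hq.part, hq.diff, hq.table, hq.card⟩, hL⟩
  · rintro q fq ⟨L, M, hq, hL0, hLc, hn0⟩
    have htab : ∀ p, HasModel H (Finset.range n) n p ↔ p ≤ q.a 2 0 n := by
      -- For n = 0 there is no representative, and the entry read is an untouched zero.
      rcases Nat.eq_zero_or_pos n with rfl | hn
      · intro p
        rw [hn0 rfl]
        refine ⟨fun h => h.le, fun h => ?_⟩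
        obtain rfl : p = 0 := by omega
        exact hasModel_zero _ _ _
      · have h0L := hL0 hn
        obtain ⟨x, rfl⟩ := Finset.card_eq_one.1 (show L.card = 1 by omega)
        obtain rfl : 0 = x := Finset.mem_singleton.1 h0L
        have hM : M 0 = Finset.range n := by
          refine (hq.part.sub 0 h0L).antisymm fun w hw => ?_
          obtain ⟨x, hx, hwx⟩ := hq.part.cover w hw
          rwa [Finset.mem_singleton.1 hx] at hwx
        rw [← hM]
        exact hq.table 0 h0L n le_rfl
    have hle : q.a 2 0 n ≤ n := ((htab _).2 le_rfl).le
    have hok : (ld 2 (lit 0) (var 0)).Ok n B q := by simp [InRange, hq.size]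
    have q1 : q.v 1 = s.v 1 := (fq.1 1 rfl).trans tv1
    refine .seq (.assign hok (.seq ?_))
    simp only [Expr.eval, hq.size]
    have e9 : (q.setVar 9 (q.a 2 0 n)).v 9 = q.a 2 0 n := by rw [St.setVar_v, if_pos rfl]
    have e1 : (q.setVar 9 (q.a 2 0 n)).v 1 = s.v 1 := by rw [St.setVar_v, if_neg (by decide), q1]
    refine .ite trivial (by simp [e9]; omega) (fun h => .assign (by simp; omega) (.assign trivial ?_))
      fun h => .assign (by simp) (.assign trivial ?_)
    · simp only [Expr.eval, e9, e1] at h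
      simp only [Expr.eval, St.setVar_v, if_true]
      simp only [show (9 : ℕ) ≠ 10 by decide, show (10 : ℕ) ≠ 1 by decide, if_false]
      exact ⟨htab, by rw [if_pos (by omega)]⟩
    · simp only [Expr.eval, e9, e1] at h
      simp only [Expr.eval, St.setVar_v, if_true]
      simp only [show (9 : ℕ) ≠ 10 by decide, show (10 : ℕ) ≠ 1 by decide, if_false]
      exact ⟨htab, by rw [if_neg (by omega)]⟩

end WordRAM

/-! ### Complete minors and their models -/

section Minors

variable {V W : Type*}

/-- In one direction the cut is the set of vertices reachable from x; in the other a walk from X to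
its complement must cross the boundary. -/
theorem connOn_iff [DecidableEq V] {G : SimpleGraph V} {B : Finset V} :
    ConnOn G B ↔ (G.induce (B : Set V)).Connected := by
  classical
  constructor
  · rintro ⟨⟨b, hb⟩, h⟩
    have : Nonempty (B : Set V) := ⟨⟨b, hb⟩⟩
    refine ⟨fun x y => ?_⟩
    set X : Finset V := B.filter fun z => ∃ hz : z ∈ (B : Set V),
      (G.induce (B : Set V)).Reachable x ⟨z, hz⟩ with hX
    by_cases hXB : X = B
    · have hy : y.1 ∈ X := by
        rw [hXB]
        exact y.2
      exact (Finset.mem_filter.1 hy).2.2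
    · obtain ⟨u, hu, v, hv, hvX, huv⟩ := h X (Finset.filter_subset _ _)
        ⟨x.1, Finset.mem_filter.2 ⟨x.2, x.2, SimpleGraph.Reachable.refl _⟩⟩ hXB
      obtain ⟨hu, hu', hr⟩ := Finset.mem_filter.1 hu
      refine absurd (Finset.mem_filter.2 ⟨hv, hv, hr.trans (SimpleGraph.Adj.reachable ?_)⟩) hvX
      simpa using huv
  · intro h
    obtain ⟨⟨b, hb⟩⟩ := h.nonempty
    refine ⟨⟨b, hb⟩, fun X hXB ⟨x, hx⟩ hne => ?_⟩
    obtain ⟨y, hy, hyX⟩ : ∃ y ∈ B, y ∉ X := by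
      by_contra! hcon
      exact hne (hXB.antisymm hcon)
    obtain ⟨w⟩ := h.preconnected ⟨x, hXB hx⟩ ⟨y, hy⟩
    obtain ⟨d, -, hd1, hd2⟩ := w.exists_boundary_dart {z | z.1 ∈ X} hx hyX
    exact ⟨d.fst.1, hd1, d.snd.1, d.snd.2, hd2, by simpa using d.adj⟩

/-- Disjoint nonempty bags are distinct, so an indexed family of bags and the set of its members
carry the same information. -/
theorem isGraphMinor_top_iff [DecidableEq V] [Fintype V] {G : SimpleGraph V} {p : ℕ} :
    IsGraphMinor (⊤ : SimpleGraph (Fin p)) G ↔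
      ∃ 𝓑, IsCliqueModel G Finset.univ 𝓑 ∧ 𝓑.card = p := by
  classical
  constructor
  · rintro ⟨bag, h1, h2, h3⟩
    have hne : ∀ x, (bag x).Nonempty := fun x => Set.nonempty_coe_sort.1 (h1 x).nonempty
    have hinj : Function.Injective fun x => (bag x).toFinset := by
      intro x y hxy
      by_contra hne'
      obtain ⟨v, hv⟩ := hne x
      exact Set.disjoint_left.1 (h2 x y hne') hv ((Set.toFinset_inj.1 hxy) ▸ hv)
    refine ⟨Finset.univ.image fun x => (bag x).toFinset, ⟨?_, ?_, ?_, ?_⟩, ?_⟩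
    · simp
    · simp only [Finset.mem_image, Finset.mem_univ, true_and, forall_exists_index,
        forall_apply_eq_imp_iff]
      intro x
      rw [connOn_iff, Set.coe_toFinset]
      exact h1 x
    · simp only [Finset.mem_image, Finset.mem_univ, true_and, forall_exists_index,
        forall_apply_eq_imp_iff]
      intro x y hxy
      rw [Set.disjoint_toFinset]
      exact h2 x y fun h => hxy (by rw [h])
    · simp only [Finset.mem_image, Finset.mem_univ, true_and, forall_exists_index,
        forall_apply_eq_imp_iff, Set.mem_toFinset]
      intro x y hxy
      exact h3 x y fun h => hxy (by rw [h])
    · rw [Finset.card_image_of_injective _ hinj, Finset.card_univ, Fintype.card_fin]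
  · rintro ⟨𝓑, h, rfl⟩
    have e := 𝓑.equivFin.symm
    refine ⟨fun x => ((e x).1 : Set V), fun x => connOn_iff.1 (h.conn _ (e x).2), fun x y hxy => ?_,
      fun x y hxy => h.touch _ (e x).2 _ (e y).2 ?_⟩
    · rw [Finset.disjoint_coe]
      exact h.disj _ (e x).2 _ (e y).2 fun h' => hxy (e.injective (Subtype.ext h'))
    · exact fun h' => hxy (e.injective (Subtype.ext h'))

/-- The program treats vertices as numbers, so models have to be moved along the embedding of `Fin
n` into the naturals. -/
theorem connOn_map [DecidableEq V] [DecidableEq W] {G : SimpleGraph V} (f : V ↪ W) {B : Finset V} :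
    ConnOn (G.map f) (B.map f) ↔ ConnOn G B := by
  constructor
  · rintro ⟨h1, h2⟩
    refine ⟨Finset.map_nonempty.1 h1, fun X hX hne hne' => ?_⟩
    obtain ⟨x, hx, y, hy, hyX, hxy⟩ := h2 (X.map f) (Finset.map_subset_map.2 hX)
      (Finset.map_nonempty.2 hne) fun h => hne' (Finset.map_injective f h)
    obtain ⟨x, hx', rfl⟩ := Finset.mem_map.1 hx
    obtain ⟨y, hy', rfl⟩ := Finset.mem_map.1 hy
    exact ⟨x, hx', y, hy', fun h => hyX (Finset.mem_map_of_mem f h),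
      (SimpleGraph.map_adj_apply).1 hxy⟩
  · rintro ⟨h1, h2⟩
    refine ⟨Finset.map_nonempty.2 h1, fun X hX hne hne' => ?_⟩
    obtain ⟨X, hXB, rfl⟩ := Finset.subset_map_iff.1 hX
    obtain ⟨x, hx, y, hy, hyX, hxy⟩ := h2 X hXB (Finset.map_nonempty.1 hne)
      fun h => hne' (by rw [h])
    refine ⟨f x, Finset.mem_map_of_mem f hx, f y, Finset.mem_map_of_mem f hy, fun h => hyX ?_,
      (SimpleGraph.map_adj_apply).2 hxy⟩
    exact (Finset.mem_map' f).1 h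

theorem isCliqueModel_map [DecidableEq V] [DecidableEq W] {G : SimpleGraph V} (f : V ↪ W)
    {S : Finset V} {𝓑 : Finset (Finset V)} :
    IsCliqueModel (G.map f) (S.map f) (𝓑.map (Finset.mapEmbedding f).toEmbedding) ↔
      IsCliqueModel G S 𝓑 := by
  have htouch : ∀ B C : Finset V, (∃ x ∈ B.map f, ∃ y ∈ C.map f, (G.map f).Adj x y) ↔
      ∃ x ∈ B, ∃ y ∈ C, G.Adj x y := by
    intro B C
    constructor
    · rintro ⟨x, hx, y, hy, hxy⟩
      obtain ⟨x, hx', rfl⟩ := Finset.mem_map.1 hx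
      obtain ⟨y, hy', rfl⟩ := Finset.mem_map.1 hy
      exact ⟨x, hx', y, hy', (SimpleGraph.map_adj_apply).1 hxy⟩
    · rintro ⟨x, hx, y, hy, hxy⟩
      exact ⟨f x, Finset.mem_map_of_mem f hx, f y, Finset.mem_map_of_mem f hy,
        (SimpleGraph.map_adj_apply).2 hxy⟩
  constructor
  · rintro ⟨h1, h2, h3, h4⟩
    simp only [Finset.mem_map, RelEmbedding.coe_toEmbedding, Finset.mapEmbedding_apply,
      forall_exists_index, and_imp, forall_apply_eq_imp_iff₂, Finset.map_subset_map, connOn_map,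
      Finset.disjoint_map] at h1 h2 h3
    refine ⟨h1, h2, fun B hB C hC hne => h3 B hB C hC fun h => hne (Finset.map_injective f h),
      fun B hB C hC hne => ?_⟩
    exact (htouch B C).1 (h4 _ (Finset.mem_map_of_mem _ hB) _ (Finset.mem_map_of_mem _ hC)
      fun h => hne (Finset.map_injective f h))
  · rintro ⟨h1, h2, h3, h4⟩
    refine ⟨?_, ?_, ?_, ?_⟩ <;>
      simp only [Finset.mem_map, RelEmbedding.coe_toEmbedding, Finset.mapEmbedding_apply,
        forall_exists_index, and_imp, forall_apply_eq_imp_iff₂, Finset.map_subset_map, connOn_map,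
        Finset.disjoint_map]
    · exact h1
    · exact h2
    · exact fun B hB C hC hne => h3 B hB C hC fun h => hne (by rw [h])
    · intro B hB C hC hne
      simpa only [Finset.mem_map] using
        (htouch B C).2 (h4 B hB C hC fun h => hne (by rw [h]))

theorem range_eq_map_univ (n : ℕ) :
    Finset.range n = (Finset.univ : Finset (Fin n)).map Fin.valEmbedding := by
  ext i
  simp only [Finset.mem_range, Finset.mem_map, Finset.mem_univ, true_and, Fin.valEmbedding_apply]
  exact ⟨fun h => ⟨⟨i, h⟩, rfl⟩, fun ⟨j, hj⟩ => hj ▸ j.2⟩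

/-- The bound n on the number of vertices is no restriction, since bags are disjoint. -/
theorem hasModel_range_iff {n : ℕ} (G : SimpleGraph (Fin n)) (p : ℕ) :
    HasModel (G.map Fin.valEmbedding) (Finset.range n) n p ↔
      IsGraphMinor (⊤ : SimpleGraph (Fin p)) G := by
  rw [isGraphMinor_top_iff, range_eq_map_univ]
  constructor
  · rintro ⟨𝓑, h, hp, -⟩
    have hsub : 𝓑 ⊆ (Finset.univ : Finset (Finset (Fin n))).map
        (Finset.mapEmbedding Fin.valEmbedding).toEmbedding := by
      intro B hB
      obtain ⟨B', -, rfl⟩ := Finset.subset_map_iff.1 (h.sub B hB)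
      exact Finset.mem_map.2 ⟨B', Finset.mem_univ _, rfl⟩
    obtain ⟨𝓒, -, rfl⟩ := Finset.subset_map_iff.1 hsub
    exact ⟨𝓒, (isCliqueModel_map _).1 h, by rw [← hp, Finset.card_map]⟩
  · rintro ⟨𝓑, h, hp⟩
    have h' := (isCliqueModel_map Fin.valEmbedding).2 h
    refine ⟨_, h', by rw [Finset.card_map, hp], ?_⟩
    simpa using h'.sum_card_le

theorem hadwigerNumber_eq {n g : ℕ} {G : SimpleGraph (Fin n)}
    (h : ∀ p, HasModel (G.map Fin.valEmbedding) (Finset.range n) n p ↔ p ≤ g) :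
    hadwigerNumber G = g := by
  have : {p : ℕ | IsGraphMinor (⊤ : SimpleGraph (Fin p)) G} = Set.Iic g := by
    ext p
    rw [Set.mem_ofPred_eq, ← hasModel_range_iff, h, Set.mem_Iic]
  rw [hadwigerNumber, this, csSup_Iic]

theorem IsCograph.isP4Free {G : SimpleGraph V} (hG : IsCograph G) : IsP4Free G := by
  intro a b c d hab hbc hcd hac hbd had
  have h1 : a ≠ c := by rintro rfl; exact had hcd
  have h2 : b ≠ d := by rintro rfl; exact had hab
  have h3 : a ≠ d := by rintro rfl; exact hac hcd.symm
  refine hG ⟨⟨⟨![a, b, c, d], ?_⟩, ?_⟩⟩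
  · intro i j hij
    fin_cases i <;> fin_cases j <;>
      simp_all [hab.ne, hbc.ne, hcd.ne, hab.ne', hbc.ne', hcd.ne', h1.symm, h2.symm, h3.symm]
  · intro i j
    change G.Adj (![a, b, c, d] i) (![a, b, c, d] j) ↔ _
    fin_cases i <;> fin_cases j <;>
      simp [SimpleGraph.pathGraph_adj, hab, hbc, hcd, hab.symm, hbc.symm, hcd.symm, hac, hbd, had,
        G.adj_comm c a, G.adj_comm d b, G.adj_comm d a]

theorem IsP4Free.map {G : SimpleGraph V} (hG : IsP4Free G) (f : V ↪ W) : IsP4Free (G.map f) := by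
  intro a b c d hab hbc hcd hac hbd had
  rw [SimpleGraph.map_adj] at hab hcd
  obtain ⟨a, b, hab, rfl, rfl⟩ := hab
  obtain ⟨c, d, hcd, rfl, rfl⟩ := hcd
  rw [SimpleGraph.map_adj_apply] at hbc hac hbd had
  exact hG a b c d hab hbc hcd hac hbd had

end Minors

/-! ### The input, the final program and its resource bounds -/

namespace WordRAM

/-- The state that represents the input. -/
noncomputable def inputSt {n : ℕ} (G : SimpleGraph (Fin n)) (h : ℕ) : St where
  v a := if a = 0 then n else if a = 1 then h else 0
  a k i j := if k = 0 then adjVal (G.map Fin.valEmbedding) i j else 0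

/-- The matrix occupies only addresses below n², so all working arrays start out as zero. -/
theorem graphInput_rel {n B : ℕ} (G : SimpleGraph (Fin n)) {h : ℕ} (hn : n + 1 ≤ B) (hh : h ≤ B) :
    Rel n B (inputSt G h) (graphInput G h) := by
  refine ⟨fun _ _ => rfl, rfl, fun k i j hi => ?_, fun a => ?_, fun a => ?_⟩
  · simp only [graphInput, inputSt]
    by_cases hk : k = 0
    · rw [InRange, if_pos hk] at hi
      have key : (∃ i' j' : Fin n, addr n k i j = i'.val * n + j'.val ∧ G.Adj i' j') ↔
          (G.map Fin.valEmbedding).Adj i j := by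
        rw [addr, if_pos hk, SimpleGraph.map_adj]
        constructor
        · rintro ⟨i', j', he, ha⟩
          obtain ⟨rfl, rfl⟩ := mul_add_inj hi.2 j'.2 he
          exact ⟨i', j', ha, rfl, rfl⟩
        · rintro ⟨i', j', ha, rfl, rfl⟩
          exact ⟨i', j', rfl, ha⟩
      rw [if_pos hk, adjVal]
      by_cases ha : (G.map Fin.valEmbedding).Adj i j
      · rw [if_pos ha]
        exact if_pos (key.2 ha)
      · rw [if_neg ha]
        exact if_neg fun h' => ha (key.1 h')
    · rw [if_neg hk]
      refine if_neg ?_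
      rintro ⟨i', j', he, -⟩
      have := addr_zero_lt i'.2 j'.2
      have := sq_le_addr (n := n) hk i j
      omega
  · simp only [graphInput]
    split_ifs <;> omega
  · simp only [graphInput]
    split_ifs <;> omega

/-- The program: the compiled command, followed by the output of the answer. -/
def hadwigerProgram : Program := hadwigerCmd.code 0 ++ [.move 0 10]

theorem hadwigerProgram_reaches {n B : ℕ} {G : SimpleGraph (Fin n)} (hG : IsCograph G) {h : ℕ}
    (hB : 100 * (n + 1) ^ 3 ≤ B) (hh : h ≤ B) :
    ∃ c, Reaches hadwigerProgram B (hadwigerCmd.cost (n + 1) + 1) (graphInput G h) c ∧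
      Halted hadwigerProgram c ∧ c.reg 0 = (if h ≤ hadwigerNumber G then 1 else 0) ∧
      c.reg 1 = hadwigerNumber G := by
  have hn : n + 1 ≤ (n + 1) ^ 3 := Nat.le_self_pow (by norm_num) _
  have hP : CodeAt hadwigerProgram 0 (hadwigerCmd.code 0 ++ [.move 0 10]) := ⟨[], [], by
    simp [hadwigerProgram], rfl⟩
  obtain ⟨hok, hmodel, hans⟩ := hadwigerCmd_tr (n := n) (B := B) (s := inputSt G h)
    (hG.isP4Free.map Fin.valEmbedding) rfl (fun _ _ _ _ => rfl) rfl rfl rfl (by omega)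
  obtain ⟨c, hr, hpc, hc⟩ := hadwigerCmd.code_reaches hB hadwigerCmd_wf hok hP.left rfl
    (graphInput_rel G (by omega) hh)
  -- Register 0 holds n for all address computations, so the answer can be moved there only at the
  -- very end.
  obtain ⟨c', hr', hpc', -, hreg, -⟩ := hP.right.reaches_reg
    (by rw [hpc, Cmd.code_length]) hc.words 0 (c.reg 10) rfl (hc.words.1 _)
  have hnum := hadwigerNumber_eq hmodel
  refine ⟨c', hr.trans hr', ?_, ?_, ?_⟩
  · rw [Halted, hpc']
    simp [hadwigerProgram]
  · rw [hreg, Function.update_self, hc.reg 10 (by norm_num), hans, hnum]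
    rfl
  · rw [hreg, Function.update_of_ne (by norm_num), hc.reg 1 (by norm_num), hnum]

end WordRAM

theorem theorem3 :
    ∃ (P : WordRAM.Program) (C k : ℕ),
      ∀ (n : ℕ) (G : SimpleGraph (Fin n)) (h : ℕ), IsCograph G →
        ∃ t : ℕ, t ≤ C * (n ^ 3 + 1) ∧
          WordRAM.Halted P (WordRAM.run P t (WordRAM.graphInput G h)) ∧
          -- register `0`: the answer to the question whether the Hadwiger number is at least `h`
          (WordRAM.run P t (WordRAM.graphInput G h)).reg 0 =
            (if h ≤ hadwigerNumber G then 1 else 0) ∧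
          -- register `1`: the Hadwiger number
          (WordRAM.run P t (WordRAM.graphInput G h)).reg 1 = hadwigerNumber G ∧
          -- words of `O(log n)` bits suffice, apart from the bits needed to write down `h`
          ∀ s ≤ t, WordRAM.WordsLE (max h (C * (n + 1) ^ k))
            (WordRAM.run P s (WordRAM.graphInput G h)) := by
  -- The factor 8 comes from (n + 1)³ ≤ 8 (n³ + 1); the summand 100 serves the word bound and pays
  -- for the final move.
  refine ⟨WordRAM.hadwigerProgram, 8 * WordRAM.hadwigerCmd.cost 1 + 100, 3, fun n G h hG => ?_⟩
  obtain ⟨c, ⟨t, ht, rfl, hw⟩, hhalt, h0, h1⟩ := WordRAM.hadwigerProgram_reaches hG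
    (B := max h ((8 * WordRAM.hadwigerCmd.cost 1 + 100) * (n + 1) ^ 3)) (h := h)
    (le_max_of_le_right (Nat.mul_le_mul_right _ (by omega))) (le_max_left _ _)
  refine ⟨t, ht.trans ?_, hhalt, h0, h1, hw⟩
  have hcost := WordRAM.hadwigerCmd.cost_le (m := n + 1) (by omega)
    WordRAM.hadwigerCmd_depth.le
  have hcube : (n + 1) ^ 3 ≤ 8 * (n ^ 3 + 1) := by
    rcases Nat.eq_zero_or_pos n with rfl | hn
    · norm_num
    · calc (n + 1) ^ 3 ≤ (2 * n) ^ 3 := Nat.pow_le_pow_left (by omega) 3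
        _ ≤ 8 * (n ^ 3 + 1) := by ring_nf; omega
  calc WordRAM.hadwigerCmd.cost (n + 1) + 1
      ≤ WordRAM.hadwigerCmd.cost 1 * (8 * (n ^ 3 + 1)) + 100 * (n ^ 3 + 1) :=
        add_le_add (hcost.trans (Nat.mul_le_mul_left _ hcube)) (by omega)
    _ = (8 * WordRAM.hadwigerCmd.cost 1 + 100) * (n ^ 3 + 1) := by ring
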